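/- Let $n\ge 2$ and $|\alpha|\le 1$. Put $v_i=e_i$ and $v_{i+n}=-e_i$ for $1\le i\le n$. For $\varepsilon>0$ consider the system $$\partial_t u_i+\tfrac1\varepsilon v_i\cdot\nabla u_i=\frac1{2n\varepsilon^2}\sum_{j=1}^{2n}(u_i+u_j)^\alpha(u_j-u_i)\quad\text{in }\mathbb R^n\times(0,\infty),\qquad u_i(\cdot,0)=g_i\ge 0,\qquad i=1,\dots,2n. \tag{1}$$ A *weak solution* on $\mathbb R^n\times[0,\tau]$ is a family of nonnegative $u_i\in C([0,\tau],L^1_{loc}(\mathbb R^n))$, bounded on $K'\times[0,\tau]$ for every compact $K'\subset\mathbb R^n$, that satisfies the equations of (1) in the sense of distributions on $\mathbb R^n\times(0,\tau)$. A *mild solution* on $\mathbb R^n\times[0,\tau]$ is a family $u_i\in C([0,\tau],L^1_{loc}(\mathbb R^n))$ with $u_i(\cdot,0)=g_i$ for which there are weak solutions $(u_i^{(m)})$, $m\in\mathbb N$, of the same equations with $\sup_{0\le t\le\tau}\|u_i^{(m)}(t)-u_i(t)\|_{L^1(\mathbb R^n)}\to0$ for each $i$. Fix constants $c>1$, $0<\hat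 c<1$ and $\bar c>\hat c$ (which may be chosen depending on $n,\alpha$ only). For $R,T>0$ define $$\overline\Psi_{R,T}(x,t)=C_\alpha\Big(\frac{T-ct}{|x|^2+R^2}\Big)^{1/\alpha},\quad (C_\alpha)^\alpha=2n^{\alpha-1}\Big(n-\frac2\alpha\Big),\qquad\text{if }-1\le\alpha<0,$$ $$\overline\Psi_{R,T}(x,t)=\frac{R^2}{(4\pi(T-t))^{\frac n2\bar c}}\,e^{\frac{\hat c\,n|x|^2}{4(T-t)}},\qquad\text{if }0\le\alpha\le1.$$ Then there are a constant $\overline C>0$, depending only on $n$, $\alpha$ and the fixed constants $c,\hat c,\bar c$, with $\overline C\le 1$ and, if $\alpha<0$, $\overline C\le 1/c$, and numbers $R_0(T)=R_0(n,\alpha,\hat c,\bar c,c,T)$, with $R_0(T)=0$ if $\alpha\le0$, such that the following holds. Let $T>0$ and $R>0$ with $R>R_0(T)$, and let $K\subset\mathbb R^n\times[0,\overline CT)$ be compact. Then there is $\varepsilon_K>0$ such that, for all $g_i\in L^1_{loc}(\mathbb R^n)$ with $$0\le g_i\le\frac1{4n}\overline\Psi_{R,T}(\cdot,0)\quad\text{a.e.},\qquad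 i=1,\dots,2n,$$ all $0<\varepsilon<\varepsilon_K$, all $\tau>0$, and every mild solution $(u_i^\varepsilon)$ of (1) on $\mathbb R^n\times[0,\tau]$ with initial data $(g_i)$, $$u_i^\varepsilon\le\frac3{4n}\overline\Psi_{R,T}\quad\text{on }K\cap(\mathbb R^n\times[0,\tau]),\qquad i=1,\dots,2n,$$ that is, for every $t\in[0,\tau]$ the inequality holds at a.e. $x$ with $(x,t)\in K$. -/

import Mathlib

open scoped ContDiff
open MeasureTheory Set Filter Topology

namespace Carleman

/-- Physical space `ℝⁿ` with the Euclidean norm. -/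
abbrev Space (n : ℕ) : Type := EuclideanSpace ℝ (Fin n)

/-- Index set of the `2n` velocities: `inl i` stands for `i`, and `inr i` for `i + n`. -/
abbrev Idx (n : ℕ) : Type := Fin n ⊕ Fin n

/-- The velocities `v_i = e_i` and `v_{i+n} = -e_i`. -/
noncomputable def vel {n : ℕ} : Idx n → Space n
  | Sum.inl i => EuclideanSpace.single i (1 : ℝ)
  | Sum.inr i => -EuclideanSpace.single i (1 : ℝ)

/-- The interaction rate `k_α(a, b) = (a + b) ^ α`, used for `a, b ≥ 0`. At `a = b = 0` and `α < 0`
its value is irrelevant, since it is always multiplied by `b - a`. -/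
noncomputable def rate (α a b : ℝ) : ℝ := (a + b) ^ α

/-- The right-hand side `(1 / (2 n ε²)) ∑_j k_α(z_j, z_i) (z_j - z_i)` of the system. -/
noncomputable def collision {n : ℕ} (α ε : ℝ) (z : Idx n → ℝ) (i : Idx n) : ℝ :=
  1 / (2 * (n : ℝ) * ε ^ 2) * ∑ j, rate α (z j) (z i) * (z j - z i)

/-- `w ∈ C([0, τ], L¹_loc(ℝⁿ))`, for `w` a function of time and space. -/
def ContinuousInL1Loc {n : ℕ} (τ : ℝ) (w : ℝ → Space n → ℝ) : Prop :=
  (∀ t ∈ Icc 0 τ, LocallyIntegrable (w t) volume) ∧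
  ∀ t₀ ∈ Icc 0 τ, ∀ K : Set (Space n), IsCompact K →
    Tendsto (fun t => ∫⁻ x in K, ‖w t x - w t₀ x‖ₑ) (𝓝[Icc 0 τ] t₀) (𝓝 0)

/-- Nonnegative weak solutions on `ℝⁿ × [0, τ]` of
`∂ₜ u_i + ε⁻¹ v_i · ∇ u_i = (1 / (2 n ε²)) ∑_j k_α(u_j, u_i) (u_j - u_i)`:
locally bounded, in `C([0, τ], L¹_loc)`, and satisfying the equations in the sense of
distributions on `ℝⁿ × (0, τ)`. The initial trace is `u i 0`, by continuity in time. -/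
structure IsWeakSolution {n : ℕ} (α ε τ : ℝ) (u : Idx n → ℝ → Space n → ℝ) : Prop where
  measurable : ∀ i, AEStronglyMeasurable (fun p : Space n × ℝ => u i p.2 p.1)
    (volume.restrict (univ ×ˢ Icc 0 τ))
  nonneg : ∀ i, ∀ t ∈ Icc 0 τ, ∀ᵐ x, 0 ≤ u i t x
  locallyBounded : ∀ i, ∀ K : Set (Space n), IsCompact K →
    ∃ M : ℝ, ∀ t ∈ Icc 0 τ, ∀ᵐ x, x ∈ K → |u i t x| ≤ M
  continuousInL1Loc : ∀ i, ContinuousInL1Loc τ (u i)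
  equation : ∀ i, ∀ φ : Space n × ℝ → ℝ, ContDiff ℝ ∞ φ → HasCompactSupport φ →
    tsupport φ ⊆ univ ×ˢ Ioo 0 τ →
    -∫ p : Space n × ℝ, u i p.2 p.1 * fderiv ℝ φ p (ε⁻¹ • vel i, 1) =
      ∫ p : Space n × ℝ, collision α ε (fun j => u j p.2 p.1) i * φ p

/-- Mild solutions on `ℝⁿ × [0, τ]` with initial data `g`: elements of `C([0, τ], L¹_loc(ℝⁿ))` that
are limits in `C([0, τ], L¹(ℝⁿ))` of weak solutions of the same system, and that are equal to `g`
at time `0`. -/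
structure IsMildSolution {n : ℕ} (α ε τ : ℝ) (g : Idx n → Space n → ℝ)
    (u : Idx n → ℝ → Space n → ℝ) : Prop where
  continuousInL1Loc : ∀ i, ContinuousInL1Loc τ (u i)
  isLimit : ∃ w : ℕ → Idx n → ℝ → Space n → ℝ,
    (∀ m, IsWeakSolution α ε τ (w m)) ∧
    ∀ i, Tendsto (fun m => ⨆ t ∈ Icc 0 τ, ∫⁻ x, ‖w m i t x - u i t x‖ₑ) atTop (𝓝 0)
  initial : ∀ i, u i 0 =ᵐ[volume] g i

/-- The constant `C_α` with `(C_α) ^ α = 2 n ^ (α - 1) (n - 2 / α)`, for `α < 0`. -/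
noncomputable def profileConst (n : ℕ) (α : ℝ) : ℝ :=
  (2 * (n : ℝ) ^ (α - 1) * ((n : ℝ) - 2 / α)) ^ (1 / α)

/-- The upper profile `Ψ̄_{R,T}(x, t)`. For `α < 0` it is a power-law profile with parameter `c`;
for `α ≥ 0` it is a growing Gaussian with parameters `cHat` and `cBar`. -/
noncomputable def upperProfile {n : ℕ} (α c cHat cBar R T : ℝ) (x : Space n) (t : ℝ) : ℝ :=
  if α < 0 then
    profileConst n α * ((T - c * t) / (‖x‖ ^ 2 + R ^ 2)) ^ (1 / α)
  else
    R ^ 2 / (4 * Real.pi * (T - t)) ^ ((n : ℝ) / 2 * cBar) *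
      Real.exp (cHat * (n : ℝ) * ‖x‖ ^ 2 / (4 * (T - t)))

end Carleman

namespace Carleman

/-! The bound follows from a comparison principle in light cones and from explicit barriers there.

Comparison. For `|α| ≤ 1` the exchange term `(a + b) ^ α (b - a)` is nondecreasing in `b` and
nonincreasing in `a`. Being antisymmetric as well, it makes the collision operator accretive in the
ordered ℓ¹ sense (`sum_collision_sub_nonpos`): summed over the components where one state exceeds
another, the difference of the collision terms is nonpositive. A weak solution is, along almost
every characteristic, a primitive of its collision term (`IsTransport.exists_representation`), so
the positive part of its excess over a smooth function can be differentiated there. All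
characteristics have speed `1/ε`; a weight supported in a backward cone of that slope decreases
along them, so no condition at infinity is needed. Weak solutions thus stay below classical
supersolutions of the cone, and mild solutions inherit this by `L¹` convergence.

Barriers. For small `ε` the components are close to a common value `ψ = exp ℓ`, with first
correction `ψ (1 - ε (2ψ)^(-α) p_i)`, `p_i = v_i · ∇ℓ` (Chapman–Enskog). With this ansatz the terms
of order `1/ε` cancel, and what remains to be checked is that `L = ∂ₜℓ` dominates a diffusion term,
`(2ψ)^(-α)` times `|∇ℓ|²` and second derivatives of `ℓ`. A cone that covers a bounded set at time
`t` has radius `O(1) + t/ε`, hence `ε ‖x‖ ≤ 2CT` in it, and the correction stays a small fraction of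
`ψ` although `‖x‖` may be of order `1/ε`.

For `α < 0` the power law makes `(2ψ)^(-α)` of size `(‖x‖² + R²)/T`, which exactly compensates the
decay of `|∇ℓ|²`. For `α > 0` a large `R` makes `(2ψ)^(-α)` small. For `α = 0` neither gain is
available: the sharp heat balance is needed, with margin `1 - cHat`, and this takes a second-order
expansion.

Constants. At time 0, `ψ` is `1/(2n)` times the profile; the correction factor lies between `1/2`
and `5/4`, and `ψ` gains at most an extra `6/5` over the growth of the profile. Since `(5/4)(6/5) =
3/2`, this gives the factors `1/(4n)` and `3/(4n)`. -/

/-! ### Absolute continuity and weak derivatives in one variable -/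

theorem absolutelyContinuousOnInterval_posPart {f : ℝ → ℝ} {a b : ℝ}
    (hf : AbsolutelyContinuousOnInterval f a b) :
    AbsolutelyContinuousOnInterval (fun t => max (f t) 0) a b := by
  rw [absolutelyContinuousOnInterval_iff] at hf ⊢
  intro ε hε
  obtain ⟨δ, hδ, h⟩ := hf ε hε
  refine ⟨δ, hδ, fun E hE hd => lt_of_le_of_lt (Finset.sum_le_sum fun i _ => ?_) (h E hE hd)⟩
  rw [Real.dist_eq, Real.dist_eq]
  exact abs_max_sub_max_le_abs _ _ _

/-- Evolution of the weighted positive part of an absolutely continuous function. -/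
theorem posPart_mul_le_integral {q V V' χ : ℝ → ℝ} {a t₁ : ℝ} {K : NNReal} (ht₁ : 0 ≤ t₁)
    (hq : IntervalIntegrable q volume 0 t₁) (hV : ∀ t, HasDerivAt V (V' t) t)
    (hV' : Continuous V') (hχ : LipschitzWith K χ) (hχ₀ : ∀ t, 0 ≤ χ t) (hχa : Antitone χ) :
    max (a + (∫ r in (0 : ℝ)..t₁, q r) - V t₁) 0 * χ t₁ ≤ max (a - V 0) 0 * χ 0 +
      ∫ r in (0 : ℝ)..t₁,
        (if 0 < a + (∫ s in (0 : ℝ)..r, q s) - V r then q r - V' r else 0) * χ r := by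
  set D : ℝ → ℝ := fun t => a + (∫ r in (0 : ℝ)..t, q r) - V t with hD
  have hVc : ContDiff ℝ 1 V := by
    rw [contDiff_one_iff_deriv]
    exact ⟨fun t => (hV t).differentiableAt, by
      rwa [show deriv V = V' from funext fun t => (hV t).deriv]⟩
  have hDac : AbsolutelyContinuousOnInterval D 0 t₁ := by
    have h1 : AbsolutelyContinuousOnInterval (fun _ : ℝ => a) 0 t₁ :=
      (LipschitzWith.const a).lipschitzOnWith.absolutelyContinuousOnInterval
    exact (h1.add (hq.absolutelyContinuousOnInterval_intervalIntegral left_mem_uIcc)).sub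
      hVc.contDiffOn.absolutelyContinuousOnInterval
  have hP := absolutelyContinuousOnInterval_posPart hDac
  have hM : AbsolutelyContinuousOnInterval (fun t => max (D t) 0 * χ t) 0 t₁ :=
    hP.mul hχ.lipschitzOnWith.absolutelyContinuousOnInterval
  have hD0 : D 0 = a - V 0 := by simp [hD]
  have hFTC := hM.integral_deriv_eq_sub
  simp only [hD0] at hFTC
  have hle : ∫ r in (0 : ℝ)..t₁, deriv (fun t => max (D t) 0 * χ t) r ≤
      ∫ r in (0 : ℝ)..t₁, (if 0 < D r then q r - V' r else 0) * χ r := by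
    apply intervalIntegral.integral_mono_ae_restrict ht₁ hM.intervalIntegrable_deriv
    · have hDm : ContinuousOn D (uIcc 0 t₁) := hDac.continuousOn
      rw [intervalIntegrable_iff_integrableOn_Ioc_of_le ht₁]
      have h1 : IntegrableOn (fun r => q r - V' r) (Ioc 0 t₁) := by
        rw [← intervalIntegrable_iff_integrableOn_Ioc_of_le ht₁]
        exact hq.sub (hV'.intervalIntegrable _ _)
      have h2 : IntegrableOn (fun r => if 0 < D r then q r - V' r else 0) (Ioc 0 t₁) := by
        refine Integrable.mono' h1.norm ?_ ?_
        · have hDm' : AEMeasurable D (volume.restrict (Ioc 0 t₁)) :=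
            (hDm.mono (by rw [uIcc_of_le ht₁]; exact Ioc_subset_Icc_self)).aemeasurable
              measurableSet_Ioc
          exact h1.aestronglyMeasurable.indicator₀
            (nullMeasurableSet_lt aemeasurable_const hDm')
        · refine ae_of_all _ fun r => ?_
          split_ifs <;> simp
      refine h2.mul_bdd (c := χ 0) hχ.continuous.aestronglyMeasurable ?_
      filter_upwards [ae_restrict_mem measurableSet_Ioc] with r hr
      rw [Real.norm_eq_abs, abs_of_nonneg (hχ₀ r)]
      exact hχa hr.1.le
    · have e1 := hDac.ae_differentiableAt
      have e2 := hP.ae_differentiableAt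
      have e3 := (hχ.lipschitzOnWith (s := uIcc 0 t₁)).absolutelyContinuousOnInterval.ae_differentiableAt
      have e4 := hq.ae_hasDerivAt_integral
      rw [EventuallyLE, ae_restrict_iff' measurableSet_Icc]
      filter_upwards [e1, e2, e3, e4] with r h1 h2 h3 h4 hr
      rw [← uIcc_of_le ht₁] at hr
      have hDd : HasDerivAt D (q r - V' r) r := by
        have := (((h4 hr) 0 left_mem_uIcc).const_add a).sub (hV r)
        exact this
      have hχd := (h3 hr).hasDerivAt
      have hχn : deriv χ r ≤ 0 := hχa.deriv_nonpos
      have hprod := (h2 hr).hasDerivAt.mul hχd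
      have hcalc : deriv (fun t => max (D t) 0 * χ t) r = _ := hprod.deriv
      rw [hcalc]
      -- The weight is nonincreasing, so the term carrying its derivative has a favourable sign and
      -- is dropped.
      have hnn : max (D r) 0 * deriv χ r ≤ 0 :=
        mul_nonpos_of_nonneg_of_nonpos (le_max_right _ _) hχn
      have hkey : deriv (fun t => max (D t) 0) r = if 0 < D r then q r - V' r else 0 := by
        split_ifs with hpos
        · have : (fun t => max (D t) 0) =ᶠ[𝓝 r] D := by
            filter_upwards [hDd.continuousAt.eventually (lt_mem_nhds hpos)] with t ht
            exact max_eq_left ht.le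
          rw [this.deriv_eq, hDd.deriv]
        -- Where `D ≤ 0`, zeros of `D` included, the positive part attains its minimum 0, so its
        -- derivative vanishes.
        · apply IsLocalMin.deriv_eq_zero
          refine Eventually.of_forall fun t => ?_
          simp only [max_eq_right (not_lt.mp hpos)]
          exact le_max_right _ _
      rw [hkey]
      linarith
  linarith

/-- A smooth function with integral zero and compact support in an open interval is the derivative
of such a function. -/
theorem exists_primitive_of_integral_eq_zero {τ : ℝ} {g : ℝ → ℝ} (hg : ContDiff ℝ ∞ g)
    (hgc : HasCompactSupport g) (hgs : tsupport g ⊆ Ioo 0 τ) (hτ : 0 < τ) (h0 : ∫ t, g t = 0) :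
    ∃ θ : ℝ → ℝ, ContDiff ℝ ∞ θ ∧ HasCompactSupport θ ∧ tsupport θ ⊆ Ioo 0 τ ∧
      ∀ t, HasDerivAt θ (g t) t := by
  -- Adding the midpoint keeps the set nonempty when `g = 0`, so that it has a least and a greatest
  -- element.
  have hK : IsCompact (insert (τ / 2) (tsupport g)) := hgc.isCompact.insert _
  have hne : (insert (τ / 2) (tsupport g)).Nonempty := insert_nonempty _ _
  have hsub : insert (τ / 2) (tsupport g) ⊆ Ioo 0 τ :=
    insert_subset ⟨by linarith, by linarith⟩ hgs
  obtain ⟨a, ha, hamin⟩ := hK.exists_isLeast hne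
  obtain ⟨b, hb, hbmax⟩ := hK.exists_isGreatest hne
  have hga : ∀ t, t ∉ Icc a b → g t = 0 := fun t ht => by
    by_contra hne
    have : t ∈ insert (τ / 2) (tsupport g) := mem_insert_of_mem _ (subset_tsupport g hne)
    exact ht ⟨hamin this, hbmax this⟩
  set θ : ℝ → ℝ := fun t => ∫ s in a..t, g s with hθ
  have hd : ∀ t, HasDerivAt θ (g t) t := fun t =>
    intervalIntegral.integral_hasDerivAt_right (hg.continuous.intervalIntegrable _ _)
      hg.continuous.stronglyMeasurable.stronglyMeasurableAtFilter hg.continuous.continuousAt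
  have hz : ∀ t, t ∉ Icc a b → θ t = 0 := by
    intro t ht
    by_cases hta : t < a
    · simp only [hθ]
      rw [intervalIntegral.integral_symm, intervalIntegral.integral_of_le hta.le,
        ← integral_Icc_eq_integral_Ioc, integral_Icc_eq_integral_Ico,
        setIntegral_eq_zero_of_forall_eq_zero, neg_zero]
      intro s hs
      exact hga s fun h => absurd hs.2 (not_lt.mpr h.1)
    · have hbt : b < t := by
        by_contra h
        exact ht ⟨not_lt.mp hta, not_lt.mp h⟩
      simp only [hθ]
      rw [intervalIntegral.integral_of_le (not_lt.mp hta), ← integral_Icc_eq_integral_Ioc,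
        setIntegral_eq_integral_of_forall_compl_eq_zero, h0]
      intro s hs
      exact hga s fun h => hs ⟨h.1, h.2.trans hbt.le⟩
  have hts : tsupport θ ⊆ Icc a b := closure_minimal (fun t ht => by
    by_contra h
    exact ht (hz t h)) isClosed_Icc
  refine ⟨θ, ?_, HasCompactSupport.of_support_subset_isCompact isCompact_Icc
    ((subset_tsupport θ).trans hts), hts.trans ?_, hd⟩
  · rw [contDiff_infty_iff_deriv]
    exact ⟨fun t => (hd t).differentiableAt, by
      rwa [show deriv θ = g from funext fun t => (hd t).deriv]⟩
  · exact fun t ht => ⟨(hsub ha).1.trans_le ht.1, ht.2.trans_lt (hsub hb).2⟩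

/-- The du Bois-Reymond lemma for continuous functions. -/
theorem eqOn_const_of_integral_mul_deriv_eq_zero {τ : ℝ} (hτ : 0 < τ) {H : ℝ → ℝ}
    (hH : ContinuousOn H (Icc 0 τ))
    (h : ∀ θ : ℝ → ℝ, ContDiff ℝ ∞ θ → HasCompactSupport θ → tsupport θ ⊆ Ioo 0 τ →
      ∫ t in Icc 0 τ, H t * deriv θ t = 0) :
    ∀ t ∈ Icc 0 τ, H t = H 0 := by
  -- A reference bump of mass one; the constant value of `H` will be its average against this bump.
  let ρ : ContDiffBump (τ / 2) := ⟨τ / 8, τ / 4, by linarith, by linarith⟩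
  set θ₀ : ℝ → ℝ := ρ.normed volume with hθ₀
  have hθ₀c : ContDiff ℝ ∞ θ₀ := ρ.contDiff_normed
  have hθ₀k : HasCompactSupport θ₀ := ρ.hasCompactSupport_normed
  have hθ₀s : tsupport θ₀ ⊆ Ioo 0 τ := by
    rw [hθ₀, ρ.tsupport_normed_eq, Real.closedBall_eq_Icc]
    intro t ht
    simp only [ρ] at ht
    exact ⟨by linarith [ht.1], by linarith [ht.2]⟩
  have hθ₀i : ∫ t, θ₀ t = 1 := ρ.integral_normed
  set c := ∫ t in Icc 0 τ, H t * θ₀ t with hc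
  have hHi : IntegrableOn H (Icc 0 τ) := hH.integrableOn_Icc
  have hmul : ∀ ψ : ℝ → ℝ, Continuous ψ → IntegrableOn (fun t => H t * ψ t) (Icc 0 τ) :=
    fun ψ hψ => (hH.mul hψ.continuousOn).integrableOn_Icc
  have key : ∀ᵐ t, t ∈ Ioo 0 τ → H t - c = 0 := by
    apply isOpen_Ioo.ae_eq_zero_of_integral_contDiff_smul_eq_zero
    · exact ((hHi.mono_set Ioo_subset_Icc_self).sub
        (integrableOn_const (by simp) )).locallyIntegrableOn
    · intro ψ hψ hψc hψs
      set m := ∫ t, ψ t with hm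
      -- Subtracting `m θ₀` makes the integral of `ψ` vanish, so the difference is the derivative of
      -- an admissible test function.
      obtain ⟨Θ, hΘ, hΘc, hΘs, hΘd⟩ := exists_primitive_of_integral_eq_zero
        (g := fun t => ψ t - m * θ₀ t) (hψ.sub (contDiff_const.mul hθ₀c))
        (hψc.sub (hθ₀k.mul_left)) ((tsupport_sub _ _).trans (union_subset hψs
          ((tsupport_mul_subset_right).trans hθ₀s))) hτ (by
          rw [integral_sub (hψ.continuous.integrable_of_hasCompactSupport hψc)
            ((hθ₀c.continuous.integrable_of_hasCompactSupport hθ₀k).const_mul m),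
            integral_const_mul, hθ₀i, mul_one, ← hm, sub_self])
      have h1 := h Θ hΘ hΘc hΘs
      have h2 : ∫ t in Icc 0 τ, H t * deriv Θ t =
          (∫ t in Icc 0 τ, H t * ψ t) - m * c := by
        rw [hc, ← integral_const_mul, ← integral_sub (hmul ψ hψ.continuous)
          ((hmul θ₀ hθ₀c.continuous).const_mul m)]
        congr 1
        ext t
        rw [(hΘd t).deriv]
        ring
      have hψz : ∀ t, t ∉ Icc 0 τ → ψ t = 0 := fun t ht =>
        image_eq_zero_of_notMem_tsupport fun h => ht (Ioo_subset_Icc_self (hψs h))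
      have h3 : ∫ t, ψ t • (H t - c) = ∫ t in Icc 0 τ, ψ t • (H t - c) := by
        rw [setIntegral_eq_integral_of_forall_compl_eq_zero]
        intro t ht
        rw [hψz t ht, zero_smul]
      have h4 : m = ∫ t in Icc 0 τ, ψ t := by
        rw [setIntegral_eq_integral_of_forall_compl_eq_zero hψz]
      rw [h3]
      have h5 : ∫ t in Icc 0 τ, ψ t • (H t - c) = (∫ t in Icc 0 τ, H t * ψ t) - m * c := by
        rw [h4, ← integral_mul_const, ← integral_sub (hmul ψ hψ.continuous)
          (hψ.continuous.continuousOn.integrableOn_Icc.mul_const c)]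
        congr 1
        ext t
        rw [smul_eq_mul]
        ring
      linarith
  have hEq : EqOn H (fun _ => c) (Icc 0 τ) := by
    apply Measure.eqOn_Icc_of_ae_eq (μ := volume) hτ.ne _ hH continuousOn_const
    rw [← Measure.restrict_congr_set Ioo_ae_eq_Icc, EventuallyEq, ae_restrict_iff' measurableSet_Ioo]
    filter_upwards [key] with t ht h
    linarith [ht h]
  intro t ht
  rw [hEq ht, hEq (left_mem_Icc.mpr hτ.le)]

/-- A continuous function with integrable weak derivative `G` is a primitive of `G`. -/
theorem eq_add_integral_of_weak_deriv {τ : ℝ} (hτ : 0 < τ) {F G : ℝ → ℝ}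
    (hF : ContinuousOn F (Icc 0 τ)) (hG : IntervalIntegrable G volume 0 τ)
    (h : ∀ θ : ℝ → ℝ, ContDiff ℝ ∞ θ → HasCompactSupport θ → tsupport θ ⊆ Ioo 0 τ →
      -∫ t in Icc 0 τ, F t * deriv θ t = ∫ t in Icc 0 τ, G t * θ t) :
    ∀ t ∈ Icc 0 τ, F t = F 0 + ∫ r in (0 : ℝ)..t, G r := by
  have hP := hG.absolutelyContinuousOnInterval_intervalIntegral left_mem_uIcc
  have hPc : ContinuousOn (fun t => ∫ r in (0 : ℝ)..t, G r) (Icc 0 τ) := by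
    have := hP.continuousOn
    rwa [uIcc_of_le hτ.le] at this
  have key := eqOn_const_of_integral_mul_deriv_eq_zero hτ (hF.sub hPc) (by
    intro θ hθ hθc hθs
    have hθ' : Continuous (deriv θ) := hθ.continuous_deriv (by simp)
    have hθac : AbsolutelyContinuousOnInterval θ 0 τ :=
      (hθ.of_le (by simp)).contDiffOn.absolutelyContinuousOnInterval
    have hz : θ τ = 0 := image_eq_zero_of_notMem_tsupport fun h => lt_irrefl _ (hθs h).2
    -- Integration by parts for the absolutely continuous primitive of `G`: it has the same weak
    -- derivative as `F`, so the difference is constant.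
    have h1 := hP.integral_mul_deriv_eq_deriv_mul hθac
    rw [hz, intervalIntegral.integral_same, mul_zero, zero_mul, sub_zero, zero_sub] at h1
    have h2 : ∫ t in (0 : ℝ)..τ, deriv (fun t => ∫ r in (0 : ℝ)..t, G r) t * θ t =
        ∫ t in (0 : ℝ)..τ, G t * θ t := by
      apply intervalIntegral.integral_congr_ae
      filter_upwards [hG.ae_hasDerivAt_integral] with t ht hmem
      rw [(ht (uIoc_subset_uIcc hmem) 0 left_mem_uIcc).deriv]
    rw [h2, intervalIntegral.integral_of_le hτ.le, intervalIntegral.integral_of_le hτ.le,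
      ← integral_Icc_eq_integral_Ioc, ← integral_Icc_eq_integral_Ioc, ← h θ hθ hθc hθs] at h1
    have h3 : ∫ t in Icc 0 τ, (F t - ∫ r in (0 : ℝ)..t, G r) * deriv θ t =
        (∫ t in Icc 0 τ, F t * deriv θ t) -
          ∫ t in Icc 0 τ, (∫ r in (0 : ℝ)..t, G r) * deriv θ t := by
      rw [← integral_sub (f := fun t => F t * deriv θ t)
        (g := fun t => (∫ r in (0 : ℝ)..t, G r) * deriv θ t)
        (hF.mul hθ'.continuousOn).integrableOn_Icc (hPc.mul hθ'.continuousOn).integrableOn_Icc]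
      congr 1
      ext t
      ring
    change ∫ t in Icc 0 τ, (F t - ∫ r in (0 : ℝ)..t, G r) * deriv θ t = 0
    rw [h3, h1]
    ring)
  intro t ht
  have := key t ht
  simp only [Pi.sub_apply, intervalIntegral.integral_same] at this
  linarith

/-! ### Transport equations along characteristics -/

/-- Jointly measurable and essentially bounded on `[0, τ] × K` for compact `K`. -/
structure LocBdd {n : ℕ} (τ : ℝ) (f : ℝ → Space n → ℝ) : Prop where
  meas : AEStronglyMeasurable (fun z : ℝ × Space n => f z.1 z.2)
    ((volume.restrict (Icc 0 τ)).prod volume)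
  bdd : ∀ K : Set (Space n), IsCompact K → ∃ M : ℝ, 0 ≤ M ∧
    ∀ᵐ z ∂((volume.restrict (Icc 0 τ)).prod volume), z.2 ∈ K → |f z.1 z.2| ≤ M

/-- The exceptional null set in the hypothesis may depend on `t`. Fubini turns it into a null set of
the product, but only for measurable sets, whence the detour through the representative `hm.mk`. -/
theorem LocBdd.of_forall {n : ℕ} {τ : ℝ} {f : ℝ → Space n → ℝ}
    (hm : AEStronglyMeasurable (fun z : ℝ × Space n => f z.1 z.2)
      ((volume.restrict (Icc 0 τ)).prod volume))
    (hb : ∀ K : Set (Space n), IsCompact K →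
      ∃ M : ℝ, ∀ t ∈ Icc 0 τ, ∀ᵐ x, x ∈ K → |f t x| ≤ M) : LocBdd τ f := by
  refine ⟨hm, fun K hK => ?_⟩
  obtain ⟨M, hM⟩ := hb K hK
  refine ⟨max M 0, le_max_right _ _, ?_⟩
  have h1 : ∀ᵐ z ∂((volume.restrict (Icc 0 τ)).prod volume),
      z.2 ∈ K → |hm.mk _ z| ≤ M := by
    have hmeas : MeasurableSet {z : ℝ × Space n | z.2 ∈ K → |hm.mk _ z| ≤ M} := by
      have h1 : MeasurableSet {z : ℝ × Space n | z.2 ∈ K} := measurable_snd hK.measurableSet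
      have h2 : MeasurableSet {z : ℝ × Space n | |hm.mk _ z| ≤ M} :=
        measurableSet_le (hm.stronglyMeasurable_mk.measurable.abs) measurable_const
      exact h1.imp h2
    rw [Measure.ae_prod_iff_ae_ae hmeas]
    have h2 := Measure.ae_ae_of_ae_prod hm.ae_eq_mk
    filter_upwards [h2, ae_restrict_mem measurableSet_Icc] with t ht htm
    filter_upwards [ht, hM t htm] with x hx hx2 hxK
    rw [← hx]
    exact hx2 hxK
  filter_upwards [h1, hm.ae_eq_mk] with z hz hz2 hzK
  rw [hz2]
  exact (hz hzK).trans (le_max_left _ _)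

theorem LocBdd.integrable_mul {n : ℕ} {τ : ℝ} {f : ℝ → Space n → ℝ} (hf : LocBdd τ f)
    {g : ℝ × Space n → ℝ}
    (hg : AEStronglyMeasurable g ((volume.restrict (Icc 0 τ)).prod volume)) {C : ℝ}
    (hC : ∀ z : ℝ × Space n, z.1 ∈ Icc 0 τ → |g z| ≤ C) {K : Set (Space n)} (hK : IsCompact K)
    (hgK : ∀ z : ℝ × Space n, z.1 ∈ Icc 0 τ → z.2 ∉ K → g z = 0) :
    Integrable (fun z : ℝ × Space n => f z.1 z.2 * g z)
      ((volume.restrict (Icc 0 τ)).prod volume) := by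
  obtain ⟨M, hM0, hM⟩ := hf.bdd K hK
  have hfin : ((volume.restrict (Icc 0 τ)).prod volume) ((univ : Set ℝ) ×ˢ K) < ⊤ := by
    rw [Measure.prod_prod]
    refine ENNReal.mul_lt_top ?_ hK.measure_lt_top
    simp
  have hint : Integrable (((univ : Set ℝ) ×ˢ K).indicator fun _ : ℝ × Space n => M * C)
      ((volume.restrict (Icc 0 τ)).prod volume) :=
    (integrable_indicator_iff (MeasurableSet.univ.prod hK.measurableSet)).2
      (integrableOn_const hfin.ne)
  have hI : ∀ᵐ z ∂((volume.restrict (Icc 0 τ)).prod (volume : Measure (Space n))),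
      z.1 ∈ Icc 0 τ :=
    Measure.quasiMeasurePreserving_fst.ae (ae_restrict_mem measurableSet_Icc)
  refine hint.mono' (hf.meas.mul hg) ?_
  filter_upwards [hM, hI] with z hz hzI
  by_cases hzK : z.2 ∈ K
  · rw [indicator_of_mem (by exact ⟨mem_univ _, hzK⟩), Real.norm_eq_abs, abs_mul]
    exact mul_le_mul (hz hzK) (hC z hzI) (abs_nonneg _) hM0
  · rw [hgK z hzI hzK, mul_zero, norm_zero, indicator_of_notMem]
    exact fun h => hzK h.2

/-- Each time slice is translated. This lets null sets and integrals pass between fixed and moving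
coordinates. -/
theorem measurePreserving_shear {n : ℕ} (τ : ℝ) (v : Space n) :
    MeasurePreserving (fun z : ℝ × Space n => (z.1, z.2 + z.1 • v))
      ((volume.restrict (Icc 0 τ)).prod volume) ((volume.restrict (Icc 0 τ)).prod volume) := by
  refine (MeasurePreserving.id _).skew_product (g := fun t x => x + t • v) ?_ ?_
  · exact Measurable.add measurable_snd (measurable_fst.smul_const v)
  · exact ae_of_all _ fun t => (measurePreserving_add_right volume (t • v)).map_eq

/-- The tube swept by a compact set moving with velocity `v` during `[0, τ]`. -/
theorem isCompact_sweep {n : ℕ} {K : Set (Space n)} (hK : IsCompact K) (τ : ℝ) (v : Space n) :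
    IsCompact ((fun z : ℝ × Space n => z.2 + z.1 • v) '' (Icc 0 τ ×ˢ K)) :=
  (isCompact_Icc.prod hK).image (by fun_prop)

theorem LocBdd.shear {n : ℕ} {τ : ℝ} {f : ℝ → Space n → ℝ} (hf : LocBdd τ f) (v : Space n) :
    LocBdd τ (fun t x => f t (x + t • v)) := by
  have hmp := measurePreserving_shear τ v
  refine ⟨hf.meas.comp_measurePreserving hmp, fun K hK => ?_⟩
  obtain ⟨M, hM0, hM⟩ := hf.bdd _ (isCompact_sweep hK τ v)
  refine ⟨M, hM0, ?_⟩
  have hI : ∀ᵐ z ∂((volume.restrict (Icc 0 τ)).prod (volume : Measure (Space n))),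
      z.1 ∈ Icc 0 τ :=
    Measure.quasiMeasurePreserving_fst.ae (ae_restrict_mem measurableSet_Icc)
  filter_upwards [hmp.quasiMeasurePreserving.ae hM, hI] with z hz hzI hzK
  exact hz ⟨z, ⟨hzI, hzK⟩, rfl⟩

theorem integral_space_time {n : ℕ} {τ : ℝ} {F : ℝ → Space n → ℝ}
    (hF : Integrable (fun z : ℝ × Space n => F z.1 z.2) ((volume.restrict (Icc 0 τ)).prod volume))
    (hz : ∀ t x, t ∉ Icc 0 τ → F t x = 0) :
    ∫ p : Space n × ℝ, F p.2 p.1 = ∫ t in Icc 0 τ, ∫ x, F t x := by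
  have h1 : ∫ p : Space n × ℝ, F p.2 p.1 =
      ∫ p in (univ : Set (Space n)) ×ˢ Icc 0 τ, F p.2 p.1 := by
    rw [setIntegral_eq_integral_of_forall_compl_eq_zero]
    intro p hp
    exact hz _ _ fun h => hp ⟨mem_univ _, h⟩
  rw [h1, Measure.volume_eq_prod, ← Measure.prod_restrict, Measure.restrict_univ,
    ← integral_prod _ hF]
  exact (integral_prod_swap (μ := volume.restrict (Icc 0 τ)) (ν := volume)
    (fun z : ℝ × Space n => F z.1 z.2))

/-- The spatial factor is constant along the characteristics, so the derivative falls on `θ` alone.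
Such test functions reduce the transport equation to a scalar weak equation in time. -/
theorem fderiv_characteristic_test {n : ℕ} {χ : Space n → ℝ} {θ : ℝ → ℝ} (hχ : ContDiff ℝ ∞ χ)
    (hθ : ContDiff ℝ ∞ θ) (v : Space n) (p : Space n × ℝ) :
    fderiv ℝ (fun p : Space n × ℝ => χ (p.1 - p.2 • v) * θ p.2) p (v, 1) =
      χ (p.1 - p.2 • v) * deriv θ p.2 := by
  have hd : ContDiff ℝ ∞ (fun p : Space n × ℝ => χ (p.1 - p.2 • v) * θ p.2) := by fun_prop
  rw [← ((hd.differentiable (by simp)) p).lineDeriv_eq_fderiv, lineDeriv]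
  have : (fun s : ℝ => χ ((p + s • (v, (1 : ℝ))).1 - (p + s • (v, (1 : ℝ))).2 • v) *
      θ (p + s • (v, (1 : ℝ))).2) = fun s => χ (p.1 - p.2 • v) * θ (p.2 + s) := by
    ext s
    simp only [Prod.fst_add, Prod.smul_fst, Prod.snd_add, Prod.smul_snd, smul_eq_mul, mul_one]
    congr 2
    rw [add_smul]
    abel
  rw [this, deriv_const_mul_field]
  simp only [deriv_comp_const_add, add_zero]

/-- Locally bounded weak solutions of `∂ₜ f + v · ∇ f = Q` on `ℝⁿ × [0, τ]`. -/
structure IsTransport {n : ℕ} (τ : ℝ) (v : Space n) (f Q : ℝ → Space n → ℝ) : Prop where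
  left : LocBdd τ f
  right : LocBdd τ Q
  cont : ContinuousInL1Loc τ f
  equation : ∀ φ : Space n × ℝ → ℝ, ContDiff ℝ ∞ φ → HasCompactSupport φ →
    tsupport φ ⊆ univ ×ˢ Ioo 0 τ →
    -∫ p : Space n × ℝ, f p.2 p.1 * fderiv ℝ φ p (v, 1) =
      ∫ p : Space n × ℝ, Q p.2 p.1 * φ p

theorem IsTransport.equation_characteristic {n : ℕ} {τ : ℝ} {v : Space n} {f Q : ℝ → Space n → ℝ}
    (h : IsTransport τ v f Q) {χ : Space n → ℝ} (hχ : ContDiff ℝ ∞ χ) (hχc : HasCompactSupport χ)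
    {θ : ℝ → ℝ} (hθ : ContDiff ℝ ∞ θ) (hθc : HasCompactSupport θ) (hθs : tsupport θ ⊆ Ioo 0 τ) :
    -∫ t in Icc 0 τ, (∫ x, f t x * χ (x - t • v)) * deriv θ t =
      ∫ t in Icc 0 τ, (∫ x, Q t x * χ (x - t • v)) * θ t := by
  set φ : Space n × ℝ → ℝ := fun p => χ (p.1 - p.2 • v) * θ p.2 with hφ
  have hK := isCompact_sweep hχc.isCompact τ v
  set K := (fun z : ℝ × Space n => z.2 + z.1 • v) '' (Icc 0 τ ×ˢ tsupport χ) with hKdef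
  have hχK : ∀ t x, t ∈ Icc 0 τ → x ∉ K → χ (x - t • v) = 0 := by
    intro t x ht hx
    apply image_eq_zero_of_notMem_tsupport
    intro hmem
    exact hx ⟨(t, x - t • v), ⟨ht, hmem⟩, by simp⟩
  have hθz : ∀ t, t ∉ Icc 0 τ → θ t = 0 := fun t ht =>
    image_eq_zero_of_notMem_tsupport fun h => ht (Ioo_subset_Icc_self (hθs h))
  have hθz' : ∀ t, t ∉ Icc 0 τ → deriv θ t = 0 := fun t ht =>
    image_eq_zero_of_notMem_tsupport fun h =>
      ht (Ioo_subset_Icc_self (hθs ((tsupport_deriv_subset) h)))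
  have hφc : HasCompactSupport φ := by
    have hc : IsCompact ((fun z : ℝ × Space n => (z.2 + z.1 • v, z.1)) ''
        (tsupport θ ×ˢ tsupport χ)) := (hθc.isCompact.prod hχc.isCompact).image (by fun_prop)
    apply HasCompactSupport.of_support_subset_isCompact hc
    intro p hp
    rw [Function.mem_support, hφ] at hp
    refine ⟨(p.2, p.1 - p.2 • v), ⟨subset_tsupport _ (right_ne_zero_of_mul hp),
      subset_tsupport _ (left_ne_zero_of_mul hp)⟩, by simp⟩
  have hφs : tsupport φ ⊆ univ ×ˢ Ioo 0 τ := by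
    have h1 : tsupport φ ⊆ univ ×ˢ tsupport θ := by
      apply closure_minimal _ (isClosed_univ.prod (isClosed_tsupport θ))
      intro p hp
      rw [Function.mem_support, hφ] at hp
      exact ⟨mem_univ _, subset_tsupport _ (right_ne_zero_of_mul hp)⟩
    exact h1.trans (prod_mono_right hθs)
  have hφd : ContDiff ℝ ∞ φ := by fun_prop
  have heq := h.equation φ hφd hφc hφs
  simp only [hφ, fderiv_characteristic_test hχ hθ] at heq
  obtain ⟨C, hC⟩ := hχ.continuous.bounded_above_of_compact_support hχc
  have hθ' : Continuous (deriv θ) := hθ.continuous_deriv (by simp)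
  obtain ⟨B, hB⟩ := hθ.continuous.bounded_above_of_compact_support hθc
  obtain ⟨B', hB'⟩ := hθ'.bounded_above_of_compact_support hθc.deriv
  have hC0 : 0 ≤ C := (norm_nonneg _).trans (hC 0)
  have aux : ∀ (w : ℝ → Space n → ℝ) (η : ℝ → ℝ) (B : ℝ), LocBdd τ w → Continuous η →
      (∀ t, ‖η t‖ ≤ B) → (∀ t, t ∉ Icc 0 τ → η t = 0) →
      ∫ p : Space n × ℝ, w p.2 p.1 * (χ (p.1 - p.2 • v) * η p.2) =
        ∫ t in Icc 0 τ, (∫ x, w t x * χ (x - t • v)) * η t := by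
    intro w η B hw hη hηB hηz
    have hint := hw.integrable_mul (g := fun z : ℝ × Space n => χ (z.2 - z.1 • v) * η z.1)
      (C := C * B) (Continuous.aestronglyMeasurable
        ((hχ.continuous.comp (by fun_prop)).mul (hη.comp continuous_fst)))
      (fun z _ => by
        rw [abs_mul]
        exact mul_le_mul (hC _) (hηB _) (abs_nonneg _) hC0) hK
      (fun z hz1 hz2 => by rw [hχK _ _ hz1 hz2, zero_mul])
    rw [integral_space_time (F := fun t x => w t x * (χ (x - t • v) * η t)) hint
      (fun t x ht => by rw [hηz t ht, mul_zero, mul_zero])]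
    congr 1
    ext t
    rw [← integral_mul_const]
    congr 1
    ext x
    ring
  rw [aux f (deriv θ) B' h.left hθ' hB' hθz', aux Q θ B h.right hθ.continuous hB hθz] at heq
  exact heq

/-- The motion of `χ` is handled by dominated convergence with `f t₀` frozen, the variation of `f`
by its `L¹` continuity on the compact tube that the support sweeps. -/
theorem ContinuousInL1Loc.continuousOn_integral {n : ℕ} {τ : ℝ} {v : Space n} {f : ℝ → Space n → ℝ}
    (h : ContinuousInL1Loc τ f) {χ : Space n → ℝ} (hχ : Continuous χ)
    (hχc : HasCompactSupport χ) :
    ContinuousOn (fun t => ∫ x, f t x * χ (x - t • v)) (Icc 0 τ) := by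
  have hK := isCompact_sweep hχc.isCompact τ v
  set K := (fun z : ℝ × Space n => z.2 + z.1 • v) '' (Icc 0 τ ×ˢ tsupport χ) with hKdef
  have hχK : ∀ t x, t ∈ Icc 0 τ → x ∉ K → χ (x - t • v) = 0 := by
    intro t x ht hx
    apply image_eq_zero_of_notMem_tsupport
    intro hmem
    exact hx ⟨(t, x - t • v), ⟨ht, hmem⟩, by simp⟩
  obtain ⟨C, hC⟩ := hχ.bounded_above_of_compact_support hχc
  have hC0 : 0 ≤ C := (norm_nonneg _).trans (hC 0)
  have hind : ∀ t ∈ Icc 0 τ, ∀ w : Space n → ℝ, ∀ x, ‖w x * χ (x - t • v)‖ ≤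
      K.indicator (fun x => C * ‖w x‖) x := by
    intro t ht w x
    by_cases hx : x ∈ K
    · rw [indicator_of_mem hx, norm_mul, mul_comm]
      exact mul_le_mul_of_nonneg_right (hC _) (norm_nonneg _)
    · rw [indicator_of_notMem hx, hχK t x ht hx, mul_zero, norm_zero]
  have hdom : ∀ w : Space n → ℝ, LocallyIntegrable w volume →
      Integrable (K.indicator (fun x => C * ‖w x‖)) volume := by
    intro w hw
    rw [integrable_indicator_iff hK.measurableSet]
    exact ((hw.integrableOn_isCompact hK).norm).const_mul C
  have hmeas : ∀ w : Space n → ℝ, LocallyIntegrable w volume → ∀ t : ℝ,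
      AEStronglyMeasurable (fun x => w x * χ (x - t • v)) volume := fun w hw t =>
    hw.aestronglyMeasurable.mul (hχ.comp (by fun_prop)).aestronglyMeasurable
  intro t₀ ht₀
  have hA : ContinuousWithinAt (fun t => ∫ x, f t₀ x * χ (x - t • v)) (Icc 0 τ) t₀ := by
    apply continuousWithinAt_of_dominated (bound := K.indicator (fun x => C * ‖f t₀ x‖))
    · exact Eventually.of_forall fun t => hmeas _ (h.1 t₀ ht₀) t
    · filter_upwards [self_mem_nhdsWithin] with t ht
      exact ae_of_all _ fun x => hind t ht _ x
    · exact hdom _ (h.1 t₀ ht₀)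
    · refine ae_of_all _ fun x => ?_
      have : Continuous fun t : ℝ => f t₀ x * χ (x - t • v) :=
        continuous_const.mul (hχ.comp (by fun_prop))
      exact this.continuousWithinAt
  have hB : Tendsto (fun t => ∫ x, (f t x - f t₀ x) * χ (x - t • v)) (𝓝[Icc 0 τ] t₀) (𝓝 0) := by
    have hlim := h.2 t₀ ht₀ K hK
    have hlim2 : Tendsto (fun t => C * (∫⁻ x in K, ‖f t x - f t₀ x‖ₑ).toReal)
        (𝓝[Icc 0 τ] t₀) (𝓝 0) := by
      have := ((ENNReal.tendsto_toReal ENNReal.zero_ne_top).comp hlim).const_mul C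
      simpa using this
    apply squeeze_zero_norm' _ hlim2
    filter_upwards [self_mem_nhdsWithin] with t ht
    have hl : LocallyIntegrable (fun x => f t x - f t₀ x) volume := (h.1 t ht).sub (h.1 t₀ ht₀)
    calc ‖∫ x, (f t x - f t₀ x) * χ (x - t • v)‖
        ≤ ∫ x, K.indicator (fun x => C * ‖f t x - f t₀ x‖) x :=
          norm_integral_le_of_norm_le (hdom _ hl)
            (ae_of_all _ fun x => hind t ht (fun x => f t x - f t₀ x) x)
      _ = C * (∫⁻ x in K, ‖f t x - f t₀ x‖ₑ).toReal := by
          rw [integral_indicator hK.measurableSet, integral_const_mul,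
            integral_norm_eq_lintegral_enorm (hl.aestronglyMeasurable.restrict)]
  have hsum := hB.add hA
  rw [zero_add] at hsum
  refine hsum.congr' ?_
  filter_upwards [self_mem_nhdsWithin] with t ht
  have hl : LocallyIntegrable (fun x => f t x - f t₀ x) volume := (h.1 t ht).sub (h.1 t₀ ht₀)
  rw [← integral_add]
  · congr 1
    ext x
    ring
  · exact (hdom _ hl).mono' (hmeas _ hl t)
      (ae_of_all _ fun x => hind t ht (fun x => f t x - f t₀ x) x)
  · exact (hdom _ (h.1 t₀ ht₀)).mono' (hmeas _ (h.1 t₀ ht₀) t)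
      (ae_of_all _ fun x => hind t ht _ x)

theorem LocBdd.congr {n : ℕ} {τ : ℝ} {f g : ℝ → Space n → ℝ} (hf : LocBdd τ f)
    (h : ∀ᵐ z ∂((volume.restrict (Icc 0 τ)).prod volume), f z.1 z.2 = g z.1 z.2) :
    LocBdd τ g := by
  refine ⟨hf.meas.congr h, fun K hK => ?_⟩
  obtain ⟨M, hM0, hM⟩ := hf.bdd K hK
  refine ⟨M, hM0, ?_⟩
  filter_upwards [hM, h] with z hz h hzK
  rw [← h]
  exact hz hzK

theorem LocBdd.integrable_prod_restrict {n : ℕ} {τ : ℝ} {f : ℝ → Space n → ℝ} (hf : LocBdd τ f)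
    {t : ℝ} (ht : t ∈ Icc 0 τ) {K : Set (Space n)} (hK : IsCompact K) :
    Integrable (fun z : ℝ × Space n => f z.1 z.2)
      ((volume.restrict (Ioc 0 t)).prod (volume.restrict K)) := by
  have hsub : Ioc 0 t ⊆ Icc 0 τ := fun r hr => ⟨hr.1.le, hr.2.trans ht.2⟩
  have hle : (volume.restrict (Ioc 0 t)).prod ((volume : Measure (Space n)).restrict K) ≤
      (volume.restrict (Icc 0 τ)).prod volume :=
    Measure.prod_mono (Measure.restrict_mono hsub le_rfl) Measure.restrict_le_self
  obtain ⟨M, -, hM⟩ := hf.bdd K hK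
  have : IsFiniteMeasure ((volume : Measure (Space n)).restrict K) :=
    ⟨by simpa using hK.measure_lt_top⟩
  refine (integrable_const M).mono' (hf.meas.mono_measure hle) ?_
  have hI : ∀ᵐ z ∂((volume.restrict (Ioc 0 t)).prod ((volume : Measure (Space n)).restrict K)),
      z.2 ∈ K :=
    Measure.quasiMeasurePreserving_snd.ae (ae_restrict_mem hK.measurableSet)
  filter_upwards [hM.filter_mono (ae_mono hle), hI] with z hz hzK
  exact hz hzK

/-- A weak solution of a transport equation is, along almost every characteristic, a primitive of
the right-hand side. -/
theorem IsTransport.exists_representation {n : ℕ} {τ : ℝ} (hτ : 0 < τ) {v : Space n}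
    {f Q : ℝ → Space n → ℝ} (h : IsTransport τ v f Q) :
    ∃ q : ℝ → Space n → ℝ, StronglyMeasurable (fun z : ℝ × Space n => q z.1 z.2) ∧ LocBdd τ q ∧
      (∀ᵐ r ∂(volume.restrict (Icc 0 τ)), ∀ᵐ y, q r y = Q r (y + r • v)) ∧
      ∀ t ∈ Icc 0 τ, ∀ᵐ y, f t (y + t • v) = f 0 y + ∫ r in (0 : ℝ)..t, q r y := by
  have hQs := h.right.shear v
  -- One measurable representative serves all `t`; only the null set of starting points `y` may
  -- depend on `t`.
  set q : ℝ → Space n → ℝ := fun r y => hQs.meas.mk _ (r, y) with hq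
  have hqae : ∀ᵐ z ∂((volume.restrict (Icc 0 τ)).prod volume),
      Q z.1 (z.2 + z.1 • v) = q z.1 z.2 := hQs.meas.ae_eq_mk
  have hqm : StronglyMeasurable (fun z : ℝ × Space n => q z.1 z.2) :=
    hQs.meas.stronglyMeasurable_mk
  have hqb : LocBdd τ q := hQs.congr hqae
  have hqQ : ∀ᵐ r ∂(volume.restrict (Icc 0 τ)), ∀ᵐ y, q r y = Q r (y + r • v) := by
    filter_upwards [Measure.ae_ae_of_ae_prod hqae] with r hr
    filter_upwards [hr] with y hy
    exact hy.symm
  refine ⟨q, hqm, hqb, hqQ, fun t ht => ?_⟩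
  have hIcc : Ioc 0 t ⊆ Icc 0 τ := fun r hr => ⟨hr.1.le, hr.2.trans ht.2⟩
  have h0mem : (0 : ℝ) ∈ Icc 0 τ := left_mem_Icc.2 hτ.le
  have hL1 : LocallyIntegrable (fun y => f t (y + t • v)) volume := by
    rw [locallyIntegrable_iff]
    intro K hK
    have hmp := measurePreserving_add_right (volume : Measure (Space n)) (t • v)
    have hemb := (MeasurableEquiv.addRight (t • v)).measurableEmbedding
    have := (hmp.integrableOn_image hemb (f := f t) (s := K)).1
      (((h.cont.1 t ht).integrableOn_isCompact (hK.image (by fun_prop))))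
    exact this
  have hL2 := h.cont.1 0 h0mem
  have hL3 : LocallyIntegrable (fun y => ∫ r in (0 : ℝ)..t, q r y) volume := by
    rw [locallyIntegrable_iff]
    intro K hK
    have := (hqb.integrable_prod_restrict ht hK).integral_prod_right
    simp only [intervalIntegral.integral_of_le ht.1]
    exact this
  have hzero : ∀ᵐ y, f t (y + t • v) - f 0 y - (∫ r in (0 : ℝ)..t, q r y) = 0 := by
    -- The identity is tested against a smooth `χ` of the starting point: the scalar equation in
    -- time is integrated, and Fubini brings the time integral inside.
    refine ae_eq_zero_of_integral_contDiff_smul_eq_zero ((hL1.sub hL2).sub hL3) ?_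
    intro χ hχ hχc
    obtain ⟨C, hC⟩ := hχ.continuous.bounded_above_of_compact_support hχc
    have hK := isCompact_sweep hχc.isCompact τ v
    set F : ℝ → ℝ := fun t => ∫ x, f t x * χ (x - t • v) with hF
    set G : ℝ → ℝ := fun t => ∫ x, Q t x * χ (x - t • v) with hG
    have hcont : ContinuousOn F (Icc 0 τ) :=
      ContinuousInL1Loc.continuousOn_integral h.cont hχ.continuous hχc
    have hint : Integrable (fun z : ℝ × Space n => Q z.1 z.2 * χ (z.2 - z.1 • v))
        ((volume.restrict (Icc 0 τ)).prod volume) := by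
      refine h.right.integrable_mul (g := fun z => χ (z.2 - z.1 • v)) (C := C)
        (hχ.continuous.comp (by fun_prop)).aestronglyMeasurable (fun z _ => hC _) hK ?_
      intro z hz1 hz2
      apply image_eq_zero_of_notMem_tsupport
      intro hmem
      exact hz2 ⟨(z.1, z.2 - z.1 • v), ⟨hz1, hmem⟩, by simp⟩
    have hGi : IntervalIntegrable G volume 0 τ := by
      rw [intervalIntegrable_iff_integrableOn_Icc_of_le hτ.le]
      exact hint.integral_prod_left
    have hrep := eq_add_integral_of_weak_deriv hτ hcont hGi
      (fun θ hθ hθc hθs => h.equation_characteristic hχ hχc hθ hθc hθs) t ht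
    have hFt : ∀ s, F s = ∫ y, χ y * f s (y + s • v) := by
      intro s
      simp only [hF]
      rw [← integral_add_right_eq_self (fun x => f s x * χ (x - s • v)) (s • v)]
      congr 1
      ext y
      rw [add_sub_cancel_right, mul_comm]
    have hGq : ∫ r in (0 : ℝ)..t, G r = ∫ y, χ y * ∫ r in (0 : ℝ)..t, q r y := by
      have hqχ : Integrable (fun z : ℝ × Space n => q z.1 z.2 * χ z.2)
          ((volume.restrict (Icc 0 τ)).prod volume) :=
        hqb.integrable_mul (g := fun z => χ z.2) (C := C)
          (hχ.continuous.comp continuous_snd).aestronglyMeasurable (fun z _ => hC _)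
          hχc.isCompact (fun z _ hz2 => image_eq_zero_of_notMem_tsupport hz2)
      have hqχ' : Integrable (fun z : ℝ × Space n => q z.1 z.2 * χ z.2)
          ((volume.restrict (Ioc 0 t)).prod volume) :=
        hqχ.mono_measure (Measure.prod_mono (Measure.restrict_mono hIcc le_rfl) le_rfl)
      calc ∫ r in (0 : ℝ)..t, G r = ∫ r in Ioc 0 t, ∫ y, q r y * χ y := by
            rw [intervalIntegral.integral_of_le ht.1]
            apply setIntegral_congr_ae measurableSet_Ioc
            rw [ae_restrict_iff' measurableSet_Icc] at hqQ
            filter_upwards [hqQ] with r hr hrt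
            simp only [hG]
            rw [← integral_add_right_eq_self (fun x => Q r x * χ (x - r • v)) (r • v)]
            apply integral_congr_ae
            filter_upwards [hr (hIcc hrt)] with y hy
            rw [add_sub_cancel_right, hy]
        _ = ∫ y, ∫ r in Ioc 0 t, q r y * χ y := integral_integral_swap hqχ'
        _ = ∫ y, χ y * ∫ r in (0 : ℝ)..t, q r y := by
            congr 1
            ext y
            rw [integral_mul_const, intervalIntegral.integral_of_le ht.1, mul_comm]
    rw [hFt t, hFt 0, hGq] at hrep
    simp only [zero_smul, add_zero] at hrep
    have hi : ∀ w : Space n → ℝ, LocallyIntegrable w volume →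
        Integrable (fun y => χ y * w y) volume := fun w hw =>
      hw.integrable_smul_left_of_hasCompactSupport hχ.continuous hχc
    simp only [smul_eq_mul, mul_sub]
    rw [integral_sub, integral_sub, hrep]
    · ring
    · exact hi _ hL1
    · exact hi _ hL2
    · exact (hi _ hL1).sub (hi _ hL2)
    · exact hi _ hL3
  filter_upwards [hzero] with y hy
  linarith

/-! ### Light cones and the positive-part inequality -/

/-- A weight supported in the backward light cone `‖x‖ + c t ≤ ρ`. -/
noncomputable def coneWeight {n : ℕ} (ρ c : ℝ) (p : Space n × ℝ) : ℝ :=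
  max 0 (ρ - ‖p.1‖ - c * p.2)

theorem coneWeight_nonneg {n : ℕ} (ρ c : ℝ) (p : Space n × ℝ) : 0 ≤ coneWeight ρ c p :=
  le_max_left _ _

theorem continuous_coneWeight {n : ℕ} (ρ c : ℝ) :
    Continuous (coneWeight ρ c : Space n × ℝ → ℝ) := by
  unfold coneWeight
  fun_prop

theorem coneWeight_le {n : ℕ} {ρ c : ℝ} (hρ : 0 ≤ ρ) (hc : 0 ≤ c) {p : Space n × ℝ}
    (hp : 0 ≤ p.2) : coneWeight ρ c p ≤ ρ := by
  have := mul_nonneg hc hp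
  have := norm_nonneg p.1
  exact max_le hρ (by linarith)

theorem coneWeight_eq_zero {n : ℕ} {ρ c : ℝ} {p : Space n × ℝ} (h : ρ ≤ ‖p.1‖ + c * p.2) :
    coneWeight ρ c p = 0 :=
  max_eq_left (by linarith)

/-- A characteristic of speed at most `c` starting outside the cone never enters it. -/
theorem coneWeight_shear_eq_zero {n : ℕ} {ρ c : ℝ} {v : Space n} (hv : ‖v‖ ≤ c) {y : Space n}
    {r : ℝ} (hr : 0 ≤ r) (hy : ρ ≤ ‖y‖) : coneWeight ρ c (y + r • v, r) = 0 := by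
  apply coneWeight_eq_zero
  have h1 : ‖y‖ ≤ ‖y + r • v‖ + ‖r • v‖ := by
    simpa using norm_sub_le (y + r • v) (r • v)
  rw [norm_smul, Real.norm_eq_abs, abs_of_nonneg hr] at h1
  have := mul_le_mul_of_nonneg_left hv hr
  simp only
  linarith

theorem norm_shear_sub_le {n : ℕ} (v y : Space n) (r s : ℝ) :
    |‖y + r • v‖ - ‖y + s • v‖| ≤ |r - s| * ‖v‖ := by
  refine (abs_norm_sub_norm_le _ _).trans ?_
  rw [add_sub_add_left_eq_sub, ← sub_smul, norm_smul, Real.norm_eq_abs]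

/-- The cone shrinks at speed `c`, and `‖y + r • v‖` decreases at rate at most `‖v‖ ≤ c`. This
monotonicity is why no boundary term appears. -/
theorem antitone_coneWeight_shear {n : ℕ} {ρ c : ℝ} {v : Space n} (hv : ‖v‖ ≤ c) (y : Space n) :
    Antitone fun r : ℝ => coneWeight ρ c (y + r • v, r) := by
  intro r s hrs
  apply max_le_max_left
  have h1 := (abs_le.1 (norm_shear_sub_le v y r s)).2
  rw [abs_of_nonpos (by linarith)] at h1
  have := mul_le_mul_of_nonneg_left hv (sub_nonneg.2 hrs)
  simp only
  linarith

theorem lipschitzWith_coneWeight_shear {n : ℕ} {ρ c : ℝ} (hc : 0 ≤ c) {v : Space n} (hv : ‖v‖ ≤ c)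
    (y : Space n) :
    LipschitzWith (2 * c).toNNReal fun r : ℝ => coneWeight ρ c (y + r • v, r) := by
  apply LipschitzWith.of_dist_le_mul
  intro r s
  rw [Real.dist_eq, Real.dist_eq, Real.coe_toNNReal _ (by linarith), coneWeight, coneWeight,
    max_comm 0, max_comm 0]
  refine (abs_max_sub_max_le_abs _ _ _).trans ?_
  have h1 := norm_shear_sub_le v y r s
  have h2 := mul_le_mul_of_nonneg_left hv (abs_nonneg (r - s))
  calc |ρ - ‖y + r • v‖ - c * r - (ρ - ‖y + s • v‖ - c * s)|
      = |-(‖y + r • v‖ - ‖y + s • v‖) + -(c * (r - s))| := by congr 1; ring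
    _ ≤ |‖y + r • v‖ - ‖y + s • v‖| + |c * (r - s)| := by
        refine (abs_add_le _ _).trans ?_
        rw [abs_neg, abs_neg]
    _ ≤ 2 * c * |r - s| := by
        rw [abs_mul, abs_of_nonneg hc]
        linarith

theorem hasCompactSupport_coneWeight {n : ℕ} {ρ c : ℝ} (hc : 0 ≤ c) {t : ℝ} (ht : 0 ≤ t) :
    HasCompactSupport fun x : Space n => coneWeight ρ c (x, t) := by
  apply HasCompactSupport.intro (isCompact_closedBall (0 : Space n) ρ)
  intro x hx
  apply coneWeight_eq_zero
  have := mul_nonneg hc ht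
  rw [mem_closedBall_zero_iff, not_le] at hx
  simp only
  linarith

theorem integrable_mul_coneWeight {n : ℕ} {w : Space n → ℝ} (hw : LocallyIntegrable w volume)
    {ρ c : ℝ} (hc : 0 ≤ c) {t : ℝ} (ht : 0 ≤ t) :
    Integrable fun x => w x * coneWeight ρ c (x, t) := by
  have := hw.integrable_smul_left_of_hasCompactSupport (g := fun x => coneWeight ρ c (x, t))
    ((continuous_coneWeight ρ c).comp (by fun_prop)) (hasCompactSupport_coneWeight hc ht)
  simpa only [smul_eq_mul, mul_comm] using this

theorem locallyIntegrable_posPart_sub {n : ℕ} {w : Space n → ℝ} (hw : LocallyIntegrable w volume)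
    {V : Space n × ℝ → ℝ} (hV : Continuous V) (t : ℝ) :
    LocallyIntegrable (fun x => max (w x - V (x, t)) 0) volume := by
  have hl : LocallyIntegrable (fun x => w x - V (x, t)) volume :=
    hw.sub (hV.comp (by fun_prop)).locallyIntegrable
  refine hl.mono ((hl.aestronglyMeasurable.aemeasurable.max
    aemeasurable_const).aestronglyMeasurable) (ae_of_all _ fun x => ?_)
  rw [Real.norm_eq_abs, Real.norm_eq_abs, abs_of_nonneg (le_max_right _ _)]
  exact max_le (le_abs_self _) (abs_nonneg _)

theorem LocBdd.sub_continuous {n : ℕ} {τ : ℝ} {f : ℝ → Space n → ℝ} (hf : LocBdd τ f)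
    {g : ℝ × Space n → ℝ} (hg : Continuous g) : LocBdd τ fun t x => f t x - g (t, x) := by
  refine ⟨hf.meas.sub hg.aestronglyMeasurable, fun K hK => ?_⟩
  obtain ⟨M, hM0, hM⟩ := hf.bdd K hK
  obtain ⟨B, hB⟩ := (isCompact_Icc.prod hK).exists_bound_of_continuousOn
    (s := Icc 0 τ ×ˢ K) hg.continuousOn
  refine ⟨M + max B 0, by positivity, ?_⟩
  have hI : ∀ᵐ z ∂((volume.restrict (Icc 0 τ)).prod (volume : Measure (Space n))),
      z.1 ∈ Icc 0 τ :=
    Measure.quasiMeasurePreserving_fst.ae (ae_restrict_mem measurableSet_Icc)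
  filter_upwards [hM, hI] with z hz hzI hzK
  have h1 := hB z ⟨hzI, hzK⟩
  rw [Real.norm_eq_abs] at h1
  exact (abs_sub _ _).trans (add_le_add (hz hzK) (h1.trans (le_max_left _ _)))

/-- The interval of integration depends on a variable, so the primitive is written as a parameter
integral of an indicator, whose joint measurability is needed for Fubini. -/
theorem stronglyMeasurable_primitive {n : ℕ} {q : ℝ → Space n → ℝ}
    (hq : StronglyMeasurable (fun z : ℝ × Space n => q z.1 z.2)) :
    StronglyMeasurable fun z : ℝ × Space n => ∫ s, (Ioc 0 z.1).indicator (fun s => q s z.2) s := by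
  have hS : MeasurableSet {p : (ℝ × Space n) × ℝ | p.2 ∈ Ioc 0 p.1.1} :=
    (measurableSet_lt measurable_const measurable_snd).inter
      (measurableSet_le measurable_snd (measurable_fst.comp measurable_fst))
  have h1 : StronglyMeasurable fun p : (ℝ × Space n) × ℝ => q p.2 p.1.2 :=
    hq.comp_measurable (measurable_snd.prodMk (measurable_snd.comp measurable_fst))
  exact (h1.indicator hS).integral_prod_right'

/-- Weighted positive part of the difference of a weak solution and a smooth function. -/
theorem IsTransport.integral_posPart_le {n : ℕ} {τ : ℝ} (hτ : 0 < τ) {v : Space n}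
    {f Q : ℝ → Space n → ℝ} (h : IsTransport τ v f Q) {V : Space n × ℝ → ℝ} (hV : ContDiff ℝ 1 V)
    {ρ c : ℝ} (hρ : 0 ≤ ρ) (hv : ‖v‖ ≤ c) {t₁ : ℝ} (ht₁ : t₁ ∈ Icc 0 τ) :
    (∀ᵐ r ∂(volume.restrict (Icc 0 τ)), Integrable fun x =>
      (if 0 < f r x - V (x, r) then Q r x - fderiv ℝ V (x, r) (v, 1) else 0) *
        coneWeight ρ c (x, r)) ∧
    IntegrableOn (fun r => ∫ x,
      (if 0 < f r x - V (x, r) then Q r x - fderiv ℝ V (x, r) (v, 1) else 0) *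
        coneWeight ρ c (x, r)) (Icc 0 τ) ∧
    ∫ x, max (f t₁ x - V (x, t₁)) 0 * coneWeight ρ c (x, t₁) ≤
      (∫ x, max (f 0 x - V (x, 0)) 0 * coneWeight ρ c (x, 0)) +
      ∫ r in Ioc 0 t₁, ∫ x,
        (if 0 < f r x - V (x, r) then Q r x - fderiv ℝ V (x, r) (v, 1) else 0) *
          coneWeight ρ c (x, r) := by
  have hc : 0 ≤ c := (norm_nonneg v).trans hv
  obtain ⟨q, hqm, hqb, hqQ, hrep⟩ := h.exists_representation hτ
  set χ : Space n × ℝ → ℝ := coneWeight ρ c with hχdef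
  have hχc : Continuous χ := continuous_coneWeight ρ c
  set V' : Space n × ℝ → ℝ := fun p => fderiv ℝ V p (v, 1) with hV'def
  have hV'c : Continuous V' := (hV.continuous_fderiv (by simp)).clm_apply continuous_const
  set S : ℝ → Space n → ℝ := fun r x =>
    (if 0 < f r x - V (x, r) then Q r x - V' (x, r) else 0) * χ (x, r) with hS
  -- `W` stands for `f` in moving coordinates: at each time it agrees with `f` almost everywhere,
  -- and it is a genuine primitive on each line. `T` is the integrand `S` rewritten with `W` and
  -- `q`.
  set W : ℝ → Space n → ℝ := fun r y => f 0 y + ∫ s in (0 : ℝ)..r, q s y with hW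
  set T : ℝ → Space n → ℝ := fun r y =>
    (if 0 < W r y - V (y + r • v, r) then q r y - V' (y + r • v, r) else 0) *
      χ (y + r • v, r) with hT
  have h0mem : (0 : ℝ) ∈ Icc 0 τ := left_mem_Icc.2 hτ.le
  have hIcc : Ioc 0 t₁ ⊆ Icc 0 τ := fun r hr => ⟨hr.1.le, hr.2.trans ht₁.2⟩
  have hI : ∀ᵐ z ∂((volume.restrict (Icc 0 τ)).prod (volume : Measure (Space n))),
      z.1 ∈ Icc 0 τ :=
    Measure.quasiMeasurePreserving_fst.ae (ae_restrict_mem measurableSet_Icc)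
  have hshc : Continuous fun z : ℝ × Space n => (z.2 + z.1 • v, z.1) := by fun_prop
  have hWm : AEStronglyMeasurable (fun z : ℝ × Space n => W z.1 z.2)
      ((volume.restrict (Icc 0 τ)).prod volume) := by
    have h1 : AEStronglyMeasurable (fun z : ℝ × Space n => f 0 z.2)
        ((volume.restrict (Icc 0 τ)).prod volume) :=
      (h.cont.1 0 h0mem).aestronglyMeasurable.comp_snd
    refine (h1.add (stronglyMeasurable_primitive hqm).aestronglyMeasurable).congr ?_
    filter_upwards [hI] with z hz
    simp only [hW, Pi.add_apply]
    rw [intervalIntegral.integral_of_le hz.1, integral_indicator measurableSet_Ioc]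
  have hTi : Integrable (fun z : ℝ × Space n => T z.1 z.2)
      ((volume.restrict (Icc 0 τ)).prod volume) := by
    have hL : LocBdd τ (fun r y => q r y - V' (y + r • v, r)) :=
      hqb.sub_continuous (hV'c.comp hshc)
    have hset : NullMeasurableSet {z : ℝ × Space n | 0 < W z.1 z.2 - V (z.2 + z.1 • v, z.1)}
        ((volume.restrict (Icc 0 τ)).prod volume) :=
      nullMeasurableSet_lt aemeasurable_const
        (hWm.sub (hV.continuous.comp hshc).aestronglyMeasurable).aemeasurable
    have hg := (hχc.comp hshc).aestronglyMeasurable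
      (μ := (volume.restrict (Icc 0 τ)).prod volume) |>.indicator₀ hset
    refine (hL.integrable_mul hg (C := ρ) ?_ (isCompact_closedBall 0 ρ) ?_).congr ?_
    · intro z hz
      simp only [indicator]
      split_ifs
      · rw [Function.comp_apply, abs_of_nonneg (coneWeight_nonneg _ _ _)]
        exact coneWeight_le hρ hc hz.1
      · simpa using hρ
    · intro z hz1 hz2
      rw [mem_closedBall_zero_iff, not_le] at hz2
      simp only [indicator]
      split_ifs
      · exact coneWeight_shear_eq_zero hv hz1.1 hz2.le
      · rfl
    · refine ae_of_all _ fun z => ?_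
      simp only [hT, indicator, mem_ofPred_eq, Function.comp_apply]
      split_ifs <;> simp
  have hTS : ∀ᵐ r ∂(volume.restrict (Icc 0 τ)), T r =ᵐ[volume] fun y => S r (y + r • v) := by
    filter_upwards [hqQ, ae_restrict_mem measurableSet_Icc] with r hr hrm
    filter_upwards [hr, hrep r hrm] with y hy hy2
    simp only [hT, hS, hW]
    rw [hy2, hy]
  have hSi : ∀ᵐ r ∂(volume.restrict (Icc 0 τ)), Integrable (S r) := by
    filter_upwards [hTS, hTi.prod_right_ae] with r hr hri
    have h1 := (hri.congr hr).comp_add_right (-(r • v))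
    simpa using h1
  have hTSi : ∀ᵐ r ∂(volume.restrict (Icc 0 τ)), ∫ y, T r y = ∫ x, S r x := by
    filter_upwards [hTS] with r hr
    rw [integral_congr_ae hr, integral_add_right_eq_self (fun x => S r x) (r • v)]
  have hSI : IntegrableOn (fun r => ∫ x, S r x) (Icc 0 τ) :=
    (hTi.integral_prod_left).congr hTSi
  refine ⟨hSi, hSI, ?_⟩
  have hend : ∀ t ∈ Icc 0 τ, Integrable (fun x => max (f t x - V (x, t)) 0 * χ (x, t)) :=
    fun t ht => integrable_mul_coneWeight
      (locallyIntegrable_posPart_sub (h.cont.1 t ht) hV.continuous t) hc ht.1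
  have hqy : ∀ᵐ y : Space n, y ∈ Metric.closedBall 0 ρ →
      IntervalIntegrable (fun r => q r y) volume 0 t₁ := by
    have h1 := (hqb.integrable_prod_restrict ht₁ (isCompact_closedBall (0 : Space n) ρ)).prod_left_ae
    rw [ae_restrict_iff' measurableSet_closedBall] at h1
    filter_upwards [h1] with y hy hmem
    rw [intervalIntegrable_iff_integrableOn_Ioc_of_le ht₁.1]
    exact hy hmem
  have hTi' : Integrable (fun z : ℝ × Space n => T z.1 z.2)
      ((volume.restrict (Ioc 0 t₁)).prod volume) :=
    hTi.mono_measure (Measure.prod_mono (Measure.restrict_mono hIcc le_rfl) le_rfl)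
  have hline : ∀ᵐ y : Space n, max (f t₁ (y + t₁ • v) - V (y + t₁ • v, t₁)) 0 *
      χ (y + t₁ • v, t₁) ≤ max (f 0 y - V (y, 0)) 0 * χ (y, 0) + ∫ r in Ioc 0 t₁, T r y := by
    filter_upwards [hqy, hrep t₁ ht₁] with y hy hy2
    -- Integrability of `q` in time is available for starting points in the ball; outside it the
    -- weight vanishes along the whole line.
    by_cases hyb : y ∈ Metric.closedBall 0 ρ
    · have hVd : ∀ t : ℝ, HasDerivAt (fun r : ℝ => V (y + r • v, r)) (V' (y + t • v, t)) t := by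
        intro t
        have hcurve : HasDerivAt (fun r : ℝ => (y + r • v, r)) (v, (1 : ℝ)) t := by
          have h1 : HasDerivAt (fun r : ℝ => y + r • v) v t := by
            simpa using ((hasDerivAt_id t).smul_const v).const_add y
          exact h1.prodMk (hasDerivAt_id t)
        have hfd : HasFDerivAt V (fderiv ℝ V (y + t • v, t)) ((fun r : ℝ => (y + r • v, r)) t) :=
          ((hV.differentiable (by simp)) (y + t • v, t)).hasFDerivAt
        exact hfd.comp_hasDerivAt (f := fun r : ℝ => (y + r • v, r)) t hcurve
      have := posPart_mul_le_integral (a := f 0 y) ht₁.1 (hy hyb) hVd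
        (hV'c.comp (by fun_prop)) (lipschitzWith_coneWeight_shear hc hv y)
        (fun t => coneWeight_nonneg ρ c _) (antitone_coneWeight_shear hv y)
      rw [hy2, ← intervalIntegral.integral_of_le ht₁.1]
      simpa only [zero_smul, add_zero] using this
    · rw [mem_closedBall_zero_iff, not_le] at hyb
      rw [hχdef, coneWeight_shear_eq_zero hv ht₁.1 hyb.le, mul_zero]
      have h1 : ∫ r in Ioc 0 t₁, T r y = 0 := by
        apply setIntegral_eq_zero_of_forall_eq_zero
        intro r hr
        simp only [hT, hχdef]
        rw [coneWeight_shear_eq_zero hv hr.1.le hyb.le, mul_zero]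
      rw [h1, add_zero]
      exact mul_nonneg (le_max_right _ _) (coneWeight_nonneg _ _ _)
  have hLi := (hend t₁ ht₁).comp_add_right (t₁ • v)
  have hRi := hTi'.integral_prod_right
  have hmono := integral_mono_ae hLi ((hend 0 h0mem).add hRi) hline
  rw [integral_add_right_eq_self (fun x => max (f t₁ x - V (x, t₁)) 0 * χ (x, t₁)) (t₁ • v)]
    at hmono
  refine hmono.trans (le_of_eq ?_)
  have hsw : ∫ y, ∫ r in Ioc 0 t₁, T r y = ∫ r in Ioc 0 t₁, ∫ y, T r y :=
    (integral_integral_swap hTi').symm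
  have hfin : ∫ r in Ioc 0 t₁, ∫ y, T r y = ∫ r in Ioc 0 t₁, ∫ x, S r x := by
    apply integral_congr_ae
    exact hTSi.filter_mono (ae_mono (Measure.restrict_mono hIcc le_rfl))
  rw [← hfin, ← hsw]
  exact integral_add (hend 0 h0mem) hRi

/-! ### Order structure of the collision operator -/

/-- The exchange term `(x + y) ^ α (x - y)` is nondecreasing in `x` if `|α| ≤ 1`. -/
theorem exchange_mono {α x x' y : ℝ} (hα : |α| ≤ 1) (hx : 0 ≤ x) (hxx : x ≤ x') (hy : 0 ≤ y)
    (hxy : 0 < x + y) : (x + y) ^ α * (x - y) ≤ (x' + y) ^ α * (x' - y) := by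
  obtain ⟨hα1, hα2⟩ := abs_le.1 hα
  have hd : ∀ b, x ≤ b → HasDerivAt (fun b => (b + y) ^ α * (b - y))
      (1 * α * (b + y) ^ (α - 1) * (b - y) + (b + y) ^ α * 1) b := by
    intro b hb
    exact (((hasDerivAt_id b).add_const y).rpow_const (Or.inl (by simp only [id]; linarith))).mul
      ((hasDerivAt_id b).sub_const y)
  have hm : MonotoneOn (fun b => (b + y) ^ α * (b - y)) (Icc x x') := by
    apply monotoneOn_of_deriv_nonneg (convex_Icc _ _)
    · exact fun b hb => (hd b hb.1).continuousAt.continuousWithinAt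
    · intro b hb
      rw [interior_Icc] at hb
      exact (hd b hb.1.le).differentiableAt.differentiableWithinAt
    · intro b hb
      rw [interior_Icc] at hb
      rw [(hd b hb.1.le).deriv]
      have hpos : 0 < b + y := by linarith [hb.1]
      have h1 : (b + y) ^ α = (b + y) ^ (α - 1) * (b + y) := by
        rw [← Real.rpow_add_one hpos.ne', sub_add_cancel]
      have hb0 : 0 ≤ b := hx.trans hb.1.le
      -- This product is the derivative; `|α| ≤ 1` is exactly what makes both coefficients
      -- nonnegative.
      have h2 : 0 ≤ (b + y) ^ (α - 1) * ((1 + α) * b + (1 - α) * y) :=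
        mul_nonneg (Real.rpow_nonneg hpos.le _)
          (add_nonneg (mul_nonneg (by linarith) hb0) (mul_nonneg (by linarith) hy))
      rw [h1]
      linarith
  exact hm (left_mem_Icc.2 hxx) (right_mem_Icc.2 hxx) hxx

/-- Monotonicity in one argument, applied twice by antisymmetry. Positivity of `a` keeps the base of
the power away from 0. -/
theorem exchange_le_exchange {α a a' b b' : ℝ} (hα : |α| ≤ 1) (ha : 0 < a) (haa : a ≤ a')
    (hb : 0 ≤ b') (hbb : b' ≤ b) :
    rate α b' a' * (b' - a') ≤ rate α b a * (b - a) := by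
  unfold rate
  have h1 := exchange_mono hα hb hbb (ha.le.trans haa) (by linarith)
  have h2 := exchange_mono hα ha.le haa (hb.trans hbb) (by linarith)
  rw [add_comm a b, add_comm a' b] at h2
  linarith

/-- By antisymmetry of `Δ`, twice the double sum of `e i * Δ i j` is that of `(e i - e j) * Δ i j`.
Only pairs with exactly one index of excess survive, and for them monotonicity of the exchange gives
the sign. -/
theorem sum_collision_sub_nonpos {n : ℕ} {α ε : ℝ} (hα : |α| ≤ 1) {z w : Idx n → ℝ}
    (hz : ∀ i, 0 ≤ z i) (hw : ∀ i, 0 < w i) :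
    ∑ i, (if 0 < z i - w i then collision α ε z i - collision α ε w i else 0) ≤ 0 := by
  set Δ : Idx n → Idx n → ℝ := fun i j =>
    rate α (z j) (z i) * (z j - z i) - rate α (w j) (w i) * (w j - w i) with hΔ
  set e : Idx n → ℝ := fun i => if 0 < z i - w i then 1 else 0 with he
  have hanti : ∀ i j, Δ j i = -Δ i j := by
    intro i j
    simp only [hΔ, rate]
    rw [add_comm (z i), add_comm (w i)]
    ring
  have hterm : ∀ i j, (e i - e j) * Δ i j ≤ 0 := by
    have hone : ∀ i j, 0 < z i - w i → ¬ 0 < z j - w j → Δ i j ≤ 0 := by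
      intro i j hi hj
      have := exchange_le_exchange hα (hw i) (a' := z i) (b' := z j) (b := w j) (by linarith)
        (hz j) (by linarith)
      simp only [hΔ]
      linarith
    intro i j
    simp only [he]
    split_ifs with hi hj hj
    · simp
    · linarith [hone i j hi hj]
    · have := hone j i hj hi
      rw [hanti] at this
      linarith
    · simp
  have hc : (0 : ℝ) ≤ 1 / (2 * (n : ℝ) * ε ^ 2) := by positivity
  have h1 : ∑ i, (if 0 < z i - w i then collision α ε z i - collision α ε w i else 0) =
      1 / (2 * (n : ℝ) * ε ^ 2) * ∑ i, ∑ j, e i * Δ i j := by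
    rw [Finset.mul_sum]
    refine Finset.sum_congr rfl fun i _ => ?_
    simp only [collision, ← Finset.mul_sum, he, hΔ, Finset.sum_sub_distrib]
    split_ifs <;> ring
  have h2 : ∑ i, ∑ j, e i * Δ i j = ∑ i, ∑ j, -(e j * Δ i j) := by
    rw [Finset.sum_comm]
    refine Finset.sum_congr rfl fun i _ => Finset.sum_congr rfl fun j _ => ?_
    rw [hanti]
    ring
  have h3 : 2 * ∑ i, ∑ j, e i * Δ i j = ∑ i, ∑ j, (e i - e j) * Δ i j := by
    rw [two_mul]
    nth_rewrite 2 [h2]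
    simp only [← Finset.sum_add_distrib]
    refine Finset.sum_congr rfl fun i _ => Finset.sum_congr rfl fun j _ => ?_
    ring
  have h4 : ∑ i, ∑ j, (e i - e j) * Δ i j ≤ 0 :=
    Finset.sum_nonpos fun i _ => Finset.sum_nonpos fun j _ => hterm i j
  rw [h1]
  exact mul_nonpos_of_nonneg_of_nonpos hc (by linarith)

/-- Since `|x - y| ≤ x + y`, the product is at most `(x + y) ^ (α + 1)` with exponent in `[0, 2]`:
the singularity for `α < 0` is absorbed, and weak solutions have locally bounded collision terms. -/
theorem abs_exchange_le {α x y M : ℝ} (hα : |α| ≤ 1) (hx : 0 ≤ x) (hy : 0 ≤ y) (hxM : x ≤ M)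
    (hyM : y ≤ M) : |rate α x y * (x - y)| ≤ (1 + 2 * M) ^ 2 := by
  obtain ⟨hα1, hα2⟩ := abs_le.1 hα
  unfold rate
  rcases (add_nonneg hx hy).eq_or_lt with h0 | hpos
  · have : x - y = 0 := by linarith
    rw [this, mul_zero, abs_zero]
    positivity
  · rw [abs_mul, abs_of_nonneg (Real.rpow_nonneg hpos.le _)]
    have h1 : |x - y| ≤ x + y := abs_le.2 ⟨by linarith, by linarith⟩
    calc (x + y) ^ α * |x - y| ≤ (x + y) ^ α * (x + y) :=
          mul_le_mul_of_nonneg_left h1 (Real.rpow_nonneg hpos.le _)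
      _ = (x + y) ^ (α + 1) := (Real.rpow_add_one hpos.ne' _).symm
      _ ≤ (1 + 2 * M) ^ (α + 1) := Real.rpow_le_rpow hpos.le (by linarith) (by linarith)
      _ ≤ (1 + 2 * M) ^ (2 : ℝ) := Real.rpow_le_rpow_of_exponent_le (by linarith) (by linarith)
      _ = (1 + 2 * M) ^ 2 := by norm_num

theorem norm_vel {n : ℕ} (i : Idx n) : ‖(vel i : Space n)‖ = 1 := by
  rcases i with i | i <;> simp [vel]

theorem IsWeakSolution.isTransport {n : ℕ} {α ε τ : ℝ} (hα : |α| ≤ 1)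
    {w : Idx n → ℝ → Space n → ℝ} (h : IsWeakSolution α ε τ w) (i : Idx n) :
    IsTransport τ (ε⁻¹ • vel i) (w i) (fun t x => collision α ε (fun j => w j t x) i) := by
  have hm : ∀ j, AEStronglyMeasurable (fun z : ℝ × Space n => w j z.1 z.2)
      ((volume.restrict (Icc 0 τ)).prod volume) := by
    intro j
    have h1 := h.measurable j
    rw [Measure.volume_eq_prod, ← Measure.prod_restrict, Measure.restrict_univ] at h1
    exact h1.prod_swap
  refine ⟨LocBdd.of_forall (hm i) (h.locallyBounded i), LocBdd.of_forall ?_ ?_,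
    h.continuousInL1Loc i, h.equation i⟩
  · have hm' := fun j => (hm j).aemeasurable
    apply AEMeasurable.aestronglyMeasurable
    unfold collision rate
    refine (Finset.aemeasurable_fun_sum _ fun j _ => ?_).const_mul _
    exact (((hm' j).add (hm' i)).pow_const α).mul ((hm' j).sub (hm' i))
  · intro K hK
    choose M hM using fun j => h.locallyBounded j K hK
    obtain ⟨B, hB⟩ := (finite_range M).bddAbove
    refine ⟨|1 / (2 * (n : ℝ) * ε ^ 2)| * ∑ _j : Idx n, (1 + 2 * B) ^ 2, fun t ht => ?_⟩
    have h1 : ∀ᵐ x, ∀ j, 0 ≤ w j t x := ae_all_iff.2 fun j => h.nonneg j t ht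
    have h2 : ∀ᵐ x, ∀ j, x ∈ K → |w j t x| ≤ M j := ae_all_iff.2 fun j => hM j t ht
    filter_upwards [h1, h2] with x hx1 hx2 hxK
    have hb : ∀ j, w j t x ≤ B := fun j =>
      (le_abs_self _).trans ((hx2 j hxK).trans (hB (mem_range_self j)))
    rw [collision, abs_mul]
    refine mul_le_mul_of_nonneg_left ?_ (abs_nonneg _)
    refine (Finset.abs_sum_le_sum_abs _ _).trans (Finset.sum_le_sum fun j _ => ?_)
    exact abs_exchange_le hα (hx1 j) (hx1 i) (hb j) (hb i)

/-! ### Comparison with supersolutions in cones -/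

/-- `U` is a positive classical supersolution of the system in the cone
`‖x‖ + t / ε < ρ`, `0 ≤ t ≤ t₁`. -/
structure IsSupersolution {n : ℕ} (α ε ρ t₁ : ℝ) (U : Idx n → Space n × ℝ → ℝ) : Prop where
  contDiff : ∀ i, ContDiff ℝ 1 (U i)
  pos : ∀ x : Space n, ∀ t ∈ Icc 0 t₁, ‖x‖ + ε⁻¹ * t < ρ → ∀ i, 0 < U i (x, t)
  le : ∀ x : Space n, ∀ t ∈ Icc 0 t₁, ‖x‖ + ε⁻¹ * t < ρ → ∀ i,
    collision α ε (fun j => U j (x, t)) i ≤ fderiv ℝ (U i) (x, t) (ε⁻¹ • vel i, 1)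

/-- The componentwise inequalities are added. Inside the cone the supersolution property and
accretivity make the total source nonpositive; outside it the weight is zero. -/
theorem IsWeakSolution.integral_posPart_le {n : ℕ} {α ε τ : ℝ} (hα : |α| ≤ 1) (hε : 0 < ε)
    (hτ : 0 < τ) {w : Idx n → ℝ → Space n → ℝ} (h : IsWeakSolution α ε τ w)
    {ρ t₁ : ℝ} (hρ : 0 ≤ ρ) (ht₁ : t₁ ∈ Icc 0 τ) {U : Idx n → Space n × ℝ → ℝ}
    (hU : IsSupersolution α ε ρ t₁ U) :
    ∑ i, ∫ x, max (w i t₁ x - U i (x, t₁)) 0 * coneWeight ρ ε⁻¹ (x, t₁) ≤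
      ∑ i, ∫ x, max (w i 0 x - U i (x, 0)) 0 * coneWeight ρ ε⁻¹ (x, 0) := by
  have hIcc : Ioc 0 t₁ ⊆ Icc 0 τ := fun r hr => ⟨hr.1.le, hr.2.trans ht₁.2⟩
  have hv : ∀ i : Idx n, ‖ε⁻¹ • (vel i : Space n)‖ ≤ ε⁻¹ := fun i => by
    rw [norm_smul, norm_vel, mul_one, Real.norm_eq_abs, abs_of_pos (inv_pos.2 hε)]
  have hcomp := fun i => (h.isTransport hα i).integral_posPart_le hτ (hU.contDiff i) hρ (hv i) ht₁
  set S : Idx n → ℝ → Space n → ℝ := fun i r x =>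
    (if 0 < w i r x - U i (x, r) then collision α ε (fun j => w j r x) i -
      fderiv ℝ (U i) (x, r) (ε⁻¹ • vel i, 1) else 0) * coneWeight ρ ε⁻¹ (x, r) with hS
  have hSx : ∀ᵐ r ∂(volume.restrict (Ioc 0 t₁)), ∀ i, Integrable (S i r) :=
    ae_all_iff.2 fun i => (hcomp i).1.filter_mono (ae_mono (Measure.restrict_mono hIcc le_rfl))
  have hSr : ∀ i, IntegrableOn (fun r => ∫ x, S i r x) (Ioc 0 t₁) :=
    fun i => (hcomp i).2.1.mono_set hIcc
  have hsum := Finset.sum_le_sum fun i (_ : i ∈ Finset.univ) => (hcomp i).2.2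
  refine hsum.trans ?_
  rw [Finset.sum_add_distrib]
  have hneg : ∑ i, ∫ r in Ioc 0 t₁, ∫ x, S i r x ≤ 0 := by
    rw [← integral_finsetSum _ fun i _ => hSr i]
    apply integral_nonpos_of_ae
    filter_upwards [hSx, ae_restrict_mem measurableSet_Ioc] with r hr hrm
    rw [← integral_finsetSum _ fun i _ => hr i]
    apply integral_nonpos_of_ae
    have hnn : ∀ᵐ x, ∀ i, 0 ≤ w i r x := ae_all_iff.2 fun i => h.nonneg i r (hIcc hrm)
    filter_upwards [hnn] with x hx
    simp only [hS, ← Finset.sum_mul, Pi.zero_apply]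
    by_cases hxρ : ‖x‖ + ε⁻¹ * r < ρ
    · refine mul_nonpos_of_nonpos_of_nonneg ?_ (coneWeight_nonneg _ _ _)
      have hmem : r ∈ Icc 0 t₁ := ⟨hrm.1.le, hrm.2⟩
      refine le_trans (Finset.sum_le_sum fun i _ => ?_)
        (sum_collision_sub_nonpos (ε := ε) hα hx (hU.pos x r hmem hxρ))
      split_ifs
      · linarith [hU.le x r hmem hxρ i]
      · rfl
    · rw [coneWeight_eq_zero (p := (x, r)) (not_lt.1 hxρ), mul_zero]
  exact add_le_of_nonpos_right hneg

/-- Comparison of mild solutions with classical supersolutions. -/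
theorem IsMildSolution.le_of_isSupersolution {n : ℕ} {α ε τ : ℝ} (hα : |α| ≤ 1) (hε : 0 < ε)
    (hτ : 0 < τ) {g : Idx n → Space n → ℝ} {u : Idx n → ℝ → Space n → ℝ}
    (h : IsMildSolution α ε τ g u) {ρ t₁ : ℝ} (hρ : 0 ≤ ρ) (ht₁ : t₁ ∈ Icc 0 τ)
    {U : Idx n → Space n × ℝ → ℝ} (hU : IsSupersolution α ε ρ t₁ U)
    (hg : ∀ i, ∀ᵐ x, ‖x‖ < ρ → g i x ≤ U i (x, 0)) (i : Idx n) :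
    ∀ᵐ x, ‖x‖ + ε⁻¹ * t₁ < ρ → u i t₁ x ≤ U i (x, t₁) := by
  have hc : 0 ≤ ε⁻¹ := (inv_pos.2 hε).le
  have h0 : (0 : ℝ) ∈ Icc 0 τ := left_mem_Icc.2 hτ.le
  obtain ⟨w, hw, hlim⟩ := h.isLimit
  have hdiff : ∀ m i, ∀ t ∈ Icc 0 τ, LocallyIntegrable (fun x => |w m i t x - u i t x|) volume :=
    fun m i t ht => by
      have hl : LocallyIntegrable (fun x => w m i t x - u i t x) volume :=
        (((hw m).continuousInL1Loc i).1 t ht).sub ((h.continuousInL1Loc i).1 t ht)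
      exact hl.mono hl.aestronglyMeasurable.norm (ae_of_all _ fun x => by simp)
  have hN : ∀ i, ∀ t ∈ Icc 0 τ, Tendsto
      (fun m => ∫ x, |w m i t x - u i t x| * coneWeight ρ ε⁻¹ (x, t)) atTop (𝓝 0) := by
    intro i t ht
    have h1 := tendsto_integral_of_L1 (μ := volume) (fun _ : Space n => (0 : ℝ))
      aestronglyMeasurable_const
      (F := fun m x => |w m i t x - u i t x| * coneWeight ρ ε⁻¹ (x, t)) (l := atTop)
      (Eventually.of_forall fun m => integrable_mul_coneWeight (hdiff m i t ht) hc ht.1) ?_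
    · simpa using h1
    -- The weight is at most `ρ`, so uniform `L¹` convergence controls the weighted errors.
    · have h2 := ENNReal.Tendsto.const_mul (a := ENNReal.ofReal ρ) (hlim i)
        (Or.inr ENNReal.ofReal_ne_top)
      rw [mul_zero] at h2
      refine tendsto_of_tendsto_of_tendsto_of_le_of_le tendsto_const_nhds h2
        (fun _ => zero_le) fun m => ?_
      calc ∫⁻ x, ‖|w m i t x - u i t x| * coneWeight ρ ε⁻¹ (x, t) - 0‖ₑ
          ≤ ∫⁻ x, ENNReal.ofReal ρ * ‖w m i t x - u i t x‖ₑ := by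
            refine lintegral_mono fun x => ?_
            rw [sub_zero, enorm_mul, mul_comm, ← Real.norm_eq_abs, enorm_norm]
            gcongr
            rw [Real.enorm_of_nonneg (coneWeight_nonneg _ _ _)]
            exact ENNReal.ofReal_le_ofReal (coneWeight_le hρ hc ht.1)
        _ = ENNReal.ofReal ρ * ∫⁻ x, ‖w m i t x - u i t x‖ₑ :=
            lintegral_const_mul' _ _ ENNReal.ofReal_ne_top
        _ ≤ ENNReal.ofReal ρ * ⨆ t ∈ Icc 0 τ, ∫⁻ x, ‖w m i t x - u i t x‖ₑ := by
            gcongr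
            exact le_iSup₂ (f := fun t (_ : t ∈ Icc 0 τ) => ∫⁻ x, ‖w m i t x - u i t x‖ₑ) t ht
  set X : Idx n → ℝ := fun i =>
    ∫ x, max (u i t₁ x - U i (x, t₁)) 0 * coneWeight ρ ε⁻¹ (x, t₁) with hX
  have hXint : ∀ i, Integrable fun x =>
      max (u i t₁ x - U i (x, t₁)) 0 * coneWeight ρ ε⁻¹ (x, t₁) := fun i =>
    integrable_mul_coneWeight (locallyIntegrable_posPart_sub ((h.continuousInL1Loc i).1 t₁ ht₁)
      (hU.contDiff i).continuous t₁) hc ht₁.1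
  have hwint : ∀ m i, ∀ t ∈ Icc 0 τ, Integrable fun x =>
      max (w m i t x - U i (x, t)) 0 * coneWeight ρ ε⁻¹ (x, t) := fun m i t ht =>
    integrable_mul_coneWeight (locallyIntegrable_posPart_sub
      (((hw m).continuousInL1Loc i).1 t ht) (hU.contDiff i).continuous t) hc ht.1
  -- The comparison is made for the locally bounded `w m`. At time 0 its excess over `U` is at most
  -- `|w m - u|` because `u = g ≤ U` there; at `t₁` the excess of `u` differs from that of `w m` by
  -- at most `|w m - u|`.
  have hbound : ∀ m, ∑ i, X i ≤
      (∑ i, ∫ x, |w m i 0 x - u i 0 x| * coneWeight ρ ε⁻¹ (x, 0)) +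
        ∑ i, ∫ x, |w m i t₁ x - u i t₁ x| * coneWeight ρ ε⁻¹ (x, t₁) := by
    intro m
    have h1 := (hw m).integral_posPart_le hα hε hτ hρ ht₁ hU
    have h2 : ∑ i, ∫ x, max (w m i 0 x - U i (x, 0)) 0 * coneWeight ρ ε⁻¹ (x, 0) ≤
        ∑ i, ∫ x, |w m i 0 x - u i 0 x| * coneWeight ρ ε⁻¹ (x, 0) := by
      refine Finset.sum_le_sum fun i _ => integral_mono_ae (hwint m i 0 h0)
        (integrable_mul_coneWeight (hdiff m i 0 h0) hc le_rfl) ?_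
      filter_upwards [hg i, h.initial i] with x hx hx2
      by_cases hxρ : ‖x‖ < ρ
      · refine mul_le_mul_of_nonneg_right (max_le ?_ (abs_nonneg _)) (coneWeight_nonneg _ _ _)
        refine le_trans ?_ (le_abs_self _)
        have := hx hxρ
        rw [← hx2] at this
        linarith
      · have : coneWeight ρ ε⁻¹ (x, (0 : ℝ)) = 0 := coneWeight_eq_zero (by simpa using hxρ)
        simp only [this, mul_zero, le_refl]
    have h3 : ∑ i, X i ≤ (∑ i, ∫ x, max (w m i t₁ x - U i (x, t₁)) 0 *
        coneWeight ρ ε⁻¹ (x, t₁)) +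
        ∑ i, ∫ x, |w m i t₁ x - u i t₁ x| * coneWeight ρ ε⁻¹ (x, t₁) := by
      rw [← Finset.sum_add_distrib]
      refine Finset.sum_le_sum fun i _ => ?_
      have hab := integrable_mul_coneWeight (ρ := ρ) (hdiff m i t₁ ht₁) hc ht₁.1
      rw [← integral_add (hwint m i t₁ ht₁) hab]
      refine integral_mono (hXint i) ((hwint m i t₁ ht₁).add hab) fun x => ?_
      simp only
      rw [← add_mul]
      refine mul_le_mul_of_nonneg_right (max_le ?_ ?_) (coneWeight_nonneg _ _ _)
      · have h1 := neg_abs_le (w m i t₁ x - u i t₁ x)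
        have h2 := le_max_left (w m i t₁ x - U i (x, t₁)) 0
        linarith
      · exact add_nonneg (le_max_right _ _) (abs_nonneg _)
    linarith
  have hlim0 := (tendsto_finsetSum Finset.univ fun i _ => hN i 0 h0).add
    (tendsto_finsetSum Finset.univ fun i _ => hN i t₁ ht₁)
  simp only [Finset.sum_const_zero, add_zero] at hlim0
  have hsum : ∑ i, X i ≤ 0 := ge_of_tendsto' hlim0 hbound
  have hXnn : ∀ i, 0 ≤ X i := fun i =>
    integral_nonneg fun x => mul_nonneg (le_max_right _ _) (coneWeight_nonneg _ _ _)
  have hXi : X i = 0 := le_antisymm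
    ((Finset.single_le_sum (fun j _ => hXnn j) (Finset.mem_univ i)).trans hsum) (hXnn i)
  have hae := (integral_eq_zero_iff_of_nonneg
    (fun x => mul_nonneg (le_max_right _ _) (coneWeight_nonneg _ _ _)) (hXint i)).1 hXi
  filter_upwards [hae] with x hx hxρ
  have hpos : 0 < coneWeight ρ ε⁻¹ (x, t₁) := by
    apply lt_max_of_lt_right
    simp only
    linarith
  have h1 : max (u i t₁ x - U i (x, t₁)) 0 = 0 := by
    rcases mul_eq_zero.1 hx with h | h
    · exact h
    · exact absurd h hpos.ne'
  have := max_eq_right_iff.1 h1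
  linarith

/-! ### Supersolutions close to equilibrium -/

/-- The power lies between those with exponents `1` and `-1`, for which the bound is elementary. -/
theorem rpow_one_sub_bounds {α z : ℝ} (hα : |α| ≤ 1) (hz : |z| ≤ 1 / 2) :
    |(1 - z) ^ α - 1| ≤ 2 * |z| := by
  obtain ⟨hα1, hα2⟩ := abs_le.1 hα
  obtain ⟨hz1, hz2⟩ := abs_le.1 hz
  have hpos : 0 < 1 - z := by linarith
  have hinv : (1 - z) ^ (-1 : ℝ) = (1 - z)⁻¹ := Real.rpow_neg_one _
  rcases le_total 0 z with h | h
  · have h1 : (1 - z) ^ (1 : ℝ) ≤ (1 - z) ^ α :=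
      Real.rpow_le_rpow_of_exponent_ge hpos (by linarith) hα2
    have h2 : (1 - z) ^ α ≤ (1 - z) ^ (-1 : ℝ) :=
      Real.rpow_le_rpow_of_exponent_ge hpos (by linarith) hα1
    have h3 : (1 - z)⁻¹ ≤ 1 + 2 * z := by
      rw [inv_le_iff_one_le_mul₀ hpos]
      nlinarith
    rw [Real.rpow_one] at h1
    rw [hinv] at h2
    rw [abs_of_nonneg h, abs_le]
    constructor <;> linarith
  · have h1 : (1 - z) ^ α ≤ (1 - z) ^ (1 : ℝ) :=
      Real.rpow_le_rpow_of_exponent_le (by linarith) hα2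
    have h2 : (1 - z) ^ (-1 : ℝ) ≤ (1 - z) ^ α :=
      Real.rpow_le_rpow_of_exponent_le (by linarith) hα1
    have h3 : 1 + 2 * z ≤ (1 - z)⁻¹ := by
      rw [← one_div, le_div_iff₀ hpos]
      nlinarith
    rw [Real.rpow_one] at h1
    rw [hinv] at h2
    rw [abs_of_nonpos h, abs_le]
    constructor <;> linarith

/-- Expansion of the collision term at a perturbation of an equilibrium. -/
theorem collision_equilibrium_le {n : ℕ} (hn : 0 < n) {α ε ψ Q : ℝ} (hα : |α| ≤ 1) (hε : 0 < ε)
    (hψ : 0 < ψ) {q : Idx n → ℝ} (hq0 : ∑ i, q i = 0) (hq : ∀ i, |q i| ≤ Q) (hQ : ε * Q ≤ 1 / 4)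
    (i : Idx n) :
    collision α ε (fun j => ψ * (1 - ε * q j)) i ≤
      ψ * ((2 * ψ) ^ α * q i / ε + (2 * ψ) ^ α * Q ^ 2) := by
  have hD : 0 < (2 * ψ) ^ α := Real.rpow_pos_of_pos (by linarith) _
  have hterm : ∀ j, rate α (ψ * (1 - ε * q j)) (ψ * (1 - ε * q i)) *
      (ψ * (1 - ε * q j) - ψ * (1 - ε * q i)) ≤
      (2 * ψ) ^ α * (ψ * ε) * ((q i - q j) + ε * Q ^ 2) := by
    intro j
    have hi := abs_le.1 (hq i)
    have hj := abs_le.1 (hq j)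
    have hQ0 : 0 ≤ Q := (abs_nonneg _).trans (hq i)
    -- The pair sum is `2ψ(1 - z)`. Replacing `(1 - z) ^ α` by 1 costs at most `2|z||q i - q j| =
    -- ε|q j ^ 2 - q i ^ 2| ≤ ε Q ^ 2`.
    set z := ε * (q j + q i) / 2 with hz
    have hzb : |z| ≤ 1 / 2 := by
      rw [hz, abs_le]
      constructor <;> nlinarith
    have hsum : ψ * (1 - ε * q j) + ψ * (1 - ε * q i) = 2 * ψ * (1 - z) := by
      rw [hz]; ring
    have hzp : 0 ≤ 1 - z := by linarith [(abs_le.1 hzb).2]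
    have hexp := rpow_one_sub_bounds hα hzb
    unfold rate
    rw [hsum, Real.mul_rpow (by linarith) hzp]
    have hmain : (1 - z) ^ α * (q i - q j) ≤ (q i - q j) + ε * Q ^ 2 := by
      have h1 : ((1 - z) ^ α - 1) * (q i - q j) ≤ 2 * |z| * |q i - q j| :=
        (le_abs_self _).trans (by rw [abs_mul]; exact mul_le_mul_of_nonneg_right hexp (abs_nonneg _))
      have h2 : 2 * |z| * |q i - q j| = ε * |(q j + q i) * (q i - q j)| := by
        rw [hz, abs_div, abs_mul, abs_mul, abs_of_pos hε, abs_two]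
        ring
      have h3 : |(q j + q i) * (q i - q j)| ≤ Q ^ 2 := by
        have hi2 : q i ^ 2 ≤ Q ^ 2 := sq_le_sq' hi.1 hi.2
        have hj2 : q j ^ 2 ≤ Q ^ 2 := sq_le_sq' hj.1 hj.2
        rw [abs_le]
        constructor <;> nlinarith [sq_nonneg (q i), sq_nonneg (q j)]
      have h4 := mul_le_mul_of_nonneg_left h3 hε.le
      linarith
    calc (2 * ψ) ^ α * (1 - z) ^ α * (ψ * (1 - ε * q j) - ψ * (1 - ε * q i))
        = (2 * ψ) ^ α * (ψ * ε) * ((1 - z) ^ α * (q i - q j)) := by ring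
      _ ≤ _ := mul_le_mul_of_nonneg_left hmain (by positivity)
  have hnR : (0 : ℝ) < n := by exact_mod_cast hn
  have hcard : (Finset.univ : Finset (Idx n)).card = 2 * n := by
    simp [two_mul]
  calc collision α ε (fun j => ψ * (1 - ε * q j)) i
      ≤ 1 / (2 * (n : ℝ) * ε ^ 2) *
          ∑ j, (2 * ψ) ^ α * (ψ * ε) * ((q i - q j) + ε * Q ^ 2) :=
        mul_le_mul_of_nonneg_left (Finset.sum_le_sum fun j _ => hterm j) (by positivity)
    _ = ψ * ((2 * ψ) ^ α * q i / ε + (2 * ψ) ^ α * Q ^ 2) := by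
        rw [← Finset.mul_sum, Finset.sum_add_distrib, Finset.sum_sub_distrib, hq0,
          Finset.sum_const, Finset.sum_const, hcard]
        simp only [nsmul_eq_mul]
        push_cast
        field_simp
        ring

/-- The collision term for constant rates. -/
theorem collision_zero {n : ℕ} (hn : 0 < n) {ε : ℝ} (z : Idx n → ℝ) (i : Idx n) :
    collision 0 ε z i = ((∑ j, z j) / (2 * n) - z i) / ε ^ 2 := by
  have hnR : (n : ℝ) ≠ 0 := by exact_mod_cast hn.ne'
  have hcard : (Finset.univ : Finset (Idx n)).card = 2 * n := by
    simp [two_mul]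
  unfold collision rate
  simp only [Real.rpow_zero, one_mul]
  rw [Finset.sum_sub_distrib, Finset.sum_const, hcard, nsmul_eq_mul]
  push_cast
  by_cases hε : ε = 0
  · simp [hε]
  · field_simp

theorem sum_inner_vel {n : ℕ} (x : Space n) : ∑ i, inner ℝ (vel i) x = 0 := by
  rw [Fintype.sum_sum_type, ← Finset.sum_add_distrib]
  exact Finset.sum_eq_zero fun k _ => by simp [vel]

theorem sum_inner_vel_sq {n : ℕ} (x : Space n) : ∑ i, inner ℝ (vel i) x ^ 2 = 2 * ‖x‖ ^ 2 := by
  rw [Fintype.sum_sum_type, ← Finset.sum_add_distrib, EuclideanSpace.norm_sq_eq, Finset.mul_sum]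
  refine Finset.sum_congr rfl fun k _ => ?_
  simp [vel, EuclideanSpace.inner_single_left]
  ring

theorem abs_inner_vel_le {n : ℕ} (i : Idx n) (x : Space n) : |inner ℝ (vel i) x| ≤ ‖x‖ := by
  simpa [norm_vel] using abs_real_inner_le_norm (vel i) x

theorem fderiv_eq_of_hasDerivAt_line {n : ℕ} {U : Space n × ℝ → ℝ} {z w : Space n × ℝ} {d : ℝ}
    (hU : DifferentiableAt ℝ U z) (h : HasDerivAt (fun s : ℝ => U (z + s • w)) d 0) :
    fderiv ℝ U z w = d := by
  rw [← hU.lineDeriv_eq_fderiv]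
  exact HasLineDerivAt.lineDeriv h

/-- `exp ℓ (1 - ε (2 exp ℓ) ^ (-α) p_i)` is a supersolution if `ℓ` grows sufficiently fast in time
and `p_i` is the derivative of `ℓ` in the direction `v_i`. -/
theorem isSupersolution_exp_mul_one_sub {n : ℕ} (hn : 0 < n) {α ε ρ t₁ : ℝ} (hα : |α| ≤ 1)
    (hε : 0 < ε) {ℓ L P dp : Space n × ℝ → ℝ} {p : Idx n → Space n × ℝ → ℝ}
    (hℓ : ContDiff ℝ 1 ℓ) (hp : ∀ i, ContDiff ℝ 1 (p i))
    (hp0 : ∀ z, ∑ i, p i z = 0) (hP : ∀ i z, |p i z| ≤ P z)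
    (hℓd : ∀ i z, fderiv ℝ ℓ z (ε⁻¹ • vel i, 1) = L z + ε⁻¹ * p i z)
    (h : ∀ x : Space n, ∀ t ∈ Icc 0 t₁, ‖x‖ + ε⁻¹ * t < ρ →
      0 ≤ L (x, t) ∧ (∀ i, fderiv ℝ (p i) (x, t) (ε⁻¹ • vel i, 1) ≤ dp (x, t)) ∧
      (2 * Real.exp (ℓ (x, t))) ^ (-α) * (ε * P (x, t)) ≤ 1 / 4 ∧
      (2 * Real.exp (ℓ (x, t))) ^ (-α) * (ε * dp (x, t) + 3 * P (x, t) ^ 2) ≤ L (x, t) / 2) :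
    IsSupersolution α ε ρ t₁
      (fun i z => Real.exp (ℓ z) * (1 - ε * ((2 * Real.exp (ℓ z)) ^ (-α) * p i z))) := by
  have hform : ∀ z, (2 * Real.exp (ℓ z)) ^ (-α) = 2 ^ (-α) * Real.exp (-α * ℓ z) := fun z => by
    rw [Real.mul_rpow (by norm_num) (Real.exp_nonneg _), ← Real.exp_mul]
    ring_nf
  have hcd : ∀ i, ContDiff ℝ 1
      (fun z => Real.exp (ℓ z) * (1 - ε * ((2 * Real.exp (ℓ z)) ^ (-α) * p i z))) := by
    intro i
    simp only [hform]
    have := hp i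
    fun_prop
  obtain ⟨hα1, hα2⟩ := abs_le.1 hα
  have hsmall : ∀ x : Space n, ∀ t ∈ Icc 0 t₁, ‖x‖ + ε⁻¹ * t < ρ → ∀ i,
      |ε * ((2 * Real.exp (ℓ (x, t))) ^ (-α) * p i (x, t))| ≤ 1 / 4 := by
    intro x t ht hx i
    obtain ⟨-, -, h3, -⟩ := h x t ht hx
    refine le_trans ?_ h3
    rw [abs_mul, abs_mul, abs_of_pos hε, abs_of_pos (Real.rpow_pos_of_pos (by positivity) _)]
    calc _ = (2 * Real.exp (ℓ (x, t))) ^ (-α) * (ε * |p i (x, t)|) := by ring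
      _ ≤ _ := by
        gcongr
        exact hP i _
  refine ⟨hcd, fun x t ht hx i => ?_, fun x t ht hx i => ?_⟩
  · refine mul_pos (Real.exp_pos _) ?_
    linarith [(abs_le.1 (hsmall x t ht hx i)).2]
  · obtain ⟨h1, h2, h3, h4⟩ := h x t ht hx
    set z : Space n × ℝ := (x, t) with hz
    set ψ := Real.exp (ℓ z) with hψ
    have hψp : 0 < ψ := Real.exp_pos _
    -- The inverse of the equilibrium rate: with this factor in the correction, the collision term
    -- reproduces `ε⁻¹ p_i` to leading order.
    set m : ℝ := (2 * ψ) ^ (-α) with hm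
    have hmp : 0 < m := Real.rpow_pos_of_pos (by positivity) _
    have hDm : (2 * ψ) ^ α * m = 1 := by
      rw [hm, ← Real.rpow_add (by positivity), add_neg_cancel, Real.rpow_zero]
    have hcoll := collision_equilibrium_le hn hα hε hψp (q := fun j => m * p j z) (Q := m * P z)
      (by rw [← Finset.mul_sum, hp0, mul_zero])
      (fun j => by
        rw [abs_mul, abs_of_pos hmp]
        exact mul_le_mul_of_nonneg_left (hP j z) hmp.le)
      (by calc ε * (m * P z) = m * (ε * P z) := by ring
        _ ≤ 1 / 4 := h3) i
    refine hcoll.trans ?_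
    set w : Space n × ℝ := (ε⁻¹ • vel i, 1) with hw
    set d := fderiv ℝ (p i) z w with hd
    have hlin : ∀ s : ℝ, HasDerivAt (fun s : ℝ => z + s • w) w s := fun s => by
      simpa using ((hasDerivAt_id s).smul_const w).const_add z
    have hℓs : HasDerivAt (fun s : ℝ => ℓ (z + s • w)) (L z + ε⁻¹ * p i z) 0 := by
      have h1 : HasFDerivAt ℓ (fderiv ℝ ℓ z) ((fun s : ℝ => z + s • w) 0) := by
        simpa using ((hℓ.differentiable (by simp)) z).hasFDerivAt
      rw [← hℓd i z]
      exact h1.comp_hasDerivAt (f := fun s : ℝ => z + s • w) 0 (hlin 0)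
    have hps : HasDerivAt (fun s : ℝ => p i (z + s • w)) d 0 := by
      have h1 : HasFDerivAt (p i) (fderiv ℝ (p i) z) ((fun s : ℝ => z + s • w) 0) := by
        simpa using (((hp i).differentiable (by simp)) z).hasFDerivAt
      exact h1.comp_hasDerivAt (f := fun s : ℝ => z + s • w) 0 (hlin 0)
    have hder := fderiv_eq_of_hasDerivAt_line ((hcd i).differentiable (by simp) z)
      (w := w) (d := ψ * (L z + ε⁻¹ * p i z) * (1 - ε * (m * p i z)) +
        ψ * (-(ε * (m * (-α * (L z + ε⁻¹ * p i z)) * p i z + m * d)))) (by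
        simp only [hform]
        have e1 := hℓs.exp
        have e2 := ((hℓs.const_mul (-α)).exp.const_mul ((2 : ℝ) ^ (-α))).mul hps
        have e3 := e1.mul ((e2.const_mul ε).const_sub 1)
        simp only [zero_smul, add_zero, Pi.mul_apply] at e3
        have hmz : m = 2 ^ (-α) * Real.exp (-α * ℓ z) := hform z
        refine e3.congr_deriv ?_
        rw [hmz]
        simp only [hψ]
        ring)
    rw [hder]
    have hd2 : d ≤ dp z := h2 i
    have hsm := abs_le.1 (hsmall x t ht hx i)
    rw [← hz, ← hψ, ← hm] at hsm
    have hpP := hP i z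
    have hpsq : p i z ^ 2 ≤ P z ^ 2 := sq_le_sq' (abs_le.1 hpP).1 (abs_le.1 hpP).2
    have hmdp : m * (ε * d) ≤ m * (ε * dp z) := by gcongr
    have hA : (2 * ψ) ^ α * (m * p i z) / ε = ε⁻¹ * p i z := by
      rw [← mul_assoc, hDm]; ring
    have hB : (2 * ψ) ^ α * (m * P z) ^ 2 = m * P z ^ 2 := by
      calc (2 * ψ) ^ α * (m * P z) ^ 2 = ((2 * ψ) ^ α * m) * (m * P z ^ 2) := by ring
        _ = m * P z ^ 2 := by rw [hDm, one_mul]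
    rw [hA, hB]
    -- In this form `ε⁻¹ p_i` cancels against the collision term. The factor of `L` is at least
    -- `1/2`; the quadratic terms cost `2 m P²` here and `m P²` from the collision, hence the 3 in
    -- the hypothesis.
    have hC : ψ * (L z + ε⁻¹ * p i z) * (1 - ε * (m * p i z)) +
        ψ * (-(ε * (m * (-α * (L z + ε⁻¹ * p i z)) * p i z + m * d))) =
        ψ * (L z * (1 - (1 - α) * (ε * (m * p i z))) + ε⁻¹ * p i z -
          (1 - α) * (m * p i z ^ 2) - m * (ε * d)) := by
      field_simp
      ring
    rw [hC]
    refine mul_le_mul_of_nonneg_left ?_ hψp.le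
    have hα0 : 0 ≤ 1 - α := by linarith
    have hL1 : (1 - α) * (ε * (m * p i z)) ≤ 1 / 2 := by
      have := mul_le_mul_of_nonneg_left hsm.2 hα0
      linarith
    have hL2 : L z * (1 / 2) ≤ L z * (1 - (1 - α) * (ε * (m * p i z))) :=
      mul_le_mul_of_nonneg_left (by linarith) h1
    have hL3 : (1 - α) * (m * p i z ^ 2) ≤ 2 * (m * P z ^ 2) :=
      mul_le_mul (by linarith) (mul_le_mul_of_nonneg_left hpsq hmp.le) (by positivity) (by norm_num)
    have h4' : m * (ε * dp z) + 3 * (m * P z ^ 2) ≤ L z / 2 := by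
      calc _ = m * (ε * dp z + 3 * P z ^ 2) := by ring
        _ ≤ _ := h4
    linarith

theorem hasDerivAt_norm_sq_line {n : ℕ} (z : Space n × ℝ) (ε : ℝ) (i : Idx n) :
    HasDerivAt (fun s : ℝ => ‖(z + s • ((ε⁻¹ • vel i, 1) : Space n × ℝ)).1‖ ^ 2)
      (2 * (ε⁻¹ * inner ℝ (vel i) z.1)) 0 := by
  have h1 : HasDerivAt (fun s : ℝ => (z + s • ((ε⁻¹ • vel i, 1) : Space n × ℝ)).1)
      (ε⁻¹ • (vel i : Space n)) 0 := by
    simpa using ((hasDerivAt_id (0 : ℝ)).smul_const (ε⁻¹ • (vel i : Space n))).const_add z.1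
  refine h1.norm_sq.congr_deriv ?_
  simp [inner_smul_right, real_inner_comm]

theorem hasDerivAt_inner_vel_line {n : ℕ} (z : Space n × ℝ) (ε : ℝ) (i : Idx n) :
    HasDerivAt (fun s : ℝ => inner ℝ (vel i) (z + s • ((ε⁻¹ • vel i, 1) : Space n × ℝ)).1)
      ε⁻¹ 0 := by
  have h1 : (fun s : ℝ => inner ℝ (vel i) (z + s • ((ε⁻¹ • vel i, 1) : Space n × ℝ)).1) =
      fun s : ℝ => inner ℝ (vel i) z.1 + s * ε⁻¹ := by
    ext s
    simp [inner_add_right, inner_smul_right, norm_vel]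
  rw [h1]
  simpa using ((hasDerivAt_id (0 : ℝ)).mul_const ε⁻¹).const_add (inner ℝ (vel i) z.1)

theorem hasDerivAt_time_line {n : ℕ} (z : Space n × ℝ) (ε : ℝ) (i : Idx n) :
    HasDerivAt (fun s : ℝ => (z + s • ((ε⁻¹ • vel i, 1) : Space n × ℝ)).2) 1 0 := by
  simpa using (hasDerivAt_id (0 : ℝ)).const_add z.2

/-- Bounds the extra growth in time of all barriers; `6/5` is what remains of the ratio `3/2` after
the correction factor `5/4`. -/
theorem exp_le_six_fifths {x : ℝ} (hx : x ≤ 1 / 6) : Real.exp x ≤ 6 / 5 := by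
  have h1 := Real.one_sub_le_exp_neg (1 / 6 : ℝ)
  have h2 : Real.exp (1 / 6) * Real.exp (-(1 / 6)) = 1 := by
    rw [← Real.exp_add, add_neg_cancel, Real.exp_zero]
  have h3 := Real.exp_pos (1 / 6)
  have h4 := Real.exp_le_exp.2 hx
  nlinarith

/-! ### Power-law barriers for `α < 0` -/

/-- Existence of supersolutions between the initial bound and the final bound, in all cones of
moderate size. -/
def HasBarriers (n : ℕ) (α c cHat cBar C R T : ℝ) : Prop :=
  ∀ ε ρ t₁ : ℝ, 0 < ε → 0 ≤ t₁ → t₁ < C * T → ε * ρ ≤ 2 * C * T →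
    ∃ U : Idx n → Space n × ℝ → ℝ, IsSupersolution α ε ρ t₁ U ∧
      (∀ i x, ‖x‖ < ρ → 1 / (4 * (n : ℝ)) * upperProfile α c cHat cBar R T x 0 ≤ U i (x, 0)) ∧
      ∀ i x, ‖x‖ + ε⁻¹ * t₁ < ρ →
        U i (x, t₁) ≤ 3 / (4 * (n : ℝ)) * upperProfile α c cHat cBar R T x t₁

theorem profileConst_pos {n : ℕ} (hn : 0 < n) {α : ℝ} (hα : α < 0) : 0 < profileConst n α := by
  have hnR : (0 : ℝ) < n := by exact_mod_cast hn
  have : 2 / α < 0 := div_neg_of_pos_of_neg two_pos hα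
  exact Real.rpow_pos_of_pos (mul_pos (mul_pos two_pos (Real.rpow_pos_of_pos hnR _))
    (by linarith)) _

theorem hasBarriers_of_neg {n : ℕ} (hn : 0 < n) {α c : ℝ} (hα₁ : -1 ≤ α) (hα₀ : α < 0)
    (hc : 1 < c) (cHat cBar : ℝ) :
    ∃ C : ℝ, 0 < C ∧ C ≤ 1 ∧ C * c ≤ 1 ∧
      ∀ R T : ℝ, 0 < R → 0 < T → HasBarriers n α c cHat cBar C R T := by
  have hnR : (0 : ℝ) < n := by exact_mod_cast hn
  have hCα := profileConst_pos hn hα₀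
  set a : ℝ := -α with ha
  have ha0 : 0 < a := by linarith
  set β : ℝ := a⁻¹ with hβ
  have hβ0 : 0 < β := inv_pos.2 ha0
  have hβa : β * a = 1 := inv_mul_cancel₀ ha0.ne'
  set b : ℝ := (profileConst n α / n) ^ a with hb
  have hb0 : 0 < b := Real.rpow_pos_of_pos (div_pos hCα hnR) _
  -- Twice the value of `(2bN/T)(2β/N + 12β²/N)`, up to the factor `1/T`: the rate of growth that
  -- pays for the diffusion term.
  set lam : ℝ := 8 * b * β + 48 * b * β ^ 2 with hlam
  have hlam0 : 0 < lam := by positivity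
  -- The last two entries keep the growth factor below `exp (1/6)` and the relative correction, at
  -- most `8bβC`, below `1/4`.
  set C : ℝ := min (min 1 (1 / c)) (min (1 / (6 * lam)) (1 / (32 * b * β))) with hC
  have hc0 : 0 < c := by linarith
  have hC0 : 0 < C := by
    refine lt_min (lt_min one_pos (by positivity)) (lt_min (by positivity) (by positivity))
  have hC1 : C ≤ 1 := (min_le_left _ _).trans (min_le_left _ _)
  have hCc : C * c ≤ 1 := by
    rw [← le_div_iff₀ hc0]
    exact (min_le_left _ _).trans (min_le_right _ _)
  have hClam : lam * C ≤ 1 / 6 := by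
    have : C ≤ 1 / (6 * lam) := (min_le_right _ _).trans (min_le_left _ _)
    rw [le_div_iff₀ (by positivity)] at this
    linarith
  have hCb : 32 * b * β * C ≤ 1 := by
    have : C ≤ 1 / (32 * b * β) := (min_le_right _ _).trans (min_le_right _ _)
    rw [le_div_iff₀ (by positivity)] at this
    linarith
  refine ⟨C, hC0, hC1, hCc, fun R T hR hT ε ρ t₁ hε ht₁ htC hερ => ?_⟩
  set N : Space n × ℝ → ℝ := fun z => ‖z.1‖ ^ 2 + R ^ 2 with hN
  have hN0 : ∀ z, 0 < N z := fun z => by positivity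
  -- Chosen so that `exp ℓ` is `1/(2n)` times the profile at time 0.
  set k : ℝ := profileConst n α * T ^ (-β) / (2 * n) with hk
  have hk0 : 0 < k := by
    have := Real.rpow_pos_of_pos hT (-β)
    positivity
  set ℓ : Space n × ℝ → ℝ := fun z => Real.log k + lam / T * z.2 + β * Real.log (N z) with hℓ
  set p : Idx n → Space n × ℝ → ℝ := fun i z => 2 * β * inner ℝ (vel i) z.1 / N z with hp
  have hNcd : ContDiff ℝ 1 N := by
    simp only [hN]
    have : ContDiff ℝ 1 fun z : Space n × ℝ => ‖z.1‖ ^ 2 := contDiff_fst.norm_sq ℝ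
    exact this.add contDiff_const
  have hℓcd : ContDiff ℝ 1 ℓ :=
    (contDiff_const.add (contDiff_const.mul contDiff_snd)).add
      (contDiff_const.mul (hNcd.log fun z => (hN0 z).ne'))
  have hpcd : ∀ i, ContDiff ℝ 1 (p i) := fun i =>
    (contDiff_const.mul (contDiff_const.inner ℝ contDiff_fst)).div hNcd fun z => (hN0 z).ne'
  have hNd : ∀ i z, HasDerivAt (fun s : ℝ => N (z + s • ((ε⁻¹ • vel i, 1) : Space n × ℝ)))
      (2 * (ε⁻¹ * inner ℝ (vel i) z.1)) 0 := fun i z =>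
    (hasDerivAt_norm_sq_line z ε i).add_const _
  have hℓd : ∀ i z, fderiv ℝ ℓ z (ε⁻¹ • vel i, 1) = lam / T + ε⁻¹ * p i z := by
    intro i z
    apply fderiv_eq_of_hasDerivAt_line ((hℓcd.differentiable (by simp)) z)
    have e1 := (((hasDerivAt_time_line z ε i).const_mul (lam / T)).const_add (Real.log k)).add
      (((hNd i z).log (by simpa using (hN0 z).ne')).const_mul β)
    refine e1.congr_deriv ?_
    simp only [hp, zero_smul, add_zero]
    ring
  have hpd : ∀ i z, fderiv ℝ (p i) z (ε⁻¹ • vel i, 1) ≤ ε⁻¹ * (2 * β / N z) := by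
    intro i z
    have e1 := ((hasDerivAt_inner_vel_line z ε i).const_mul (2 * β)).div (hNd i z)
      (by simpa using (hN0 z).ne')
    have e2 := fderiv_eq_of_hasDerivAt_line ((hpcd i).differentiable (by simp) z) e1
    rw [e2]
    simp only [zero_smul, add_zero]
    have hNz := hN0 z
    have : ε⁻¹ * (2 * β / N z) = (2 * β * ε⁻¹ * N z) / N z ^ 2 := by
      field_simp
    rw [this]
    gcongr
    -- The term from differentiating the denominator enters with a minus sign and is dropped.
    have h3 : 0 ≤ 2 * β * inner ℝ (vel i) z.1 * (2 * (ε⁻¹ * inner ℝ (vel i) z.1)) := by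
      have : 2 * β * inner ℝ (vel i) z.1 * (2 * (ε⁻¹ * inner ℝ (vel i) z.1)) =
        4 * β * ε⁻¹ * inner ℝ (vel i) z.1 ^ 2 := by ring
      rw [this]
      positivity
    linarith
  have hexp : ∀ z, Real.exp (ℓ z) = k * Real.exp (lam / T * z.2) * N z ^ β := fun z => by
    simp only [hℓ]
    rw [Real.exp_add, Real.exp_add, Real.exp_log hk0, Real.rpow_def_of_pos (hN0 z), mul_comm β]
  have htime : ∀ t ∈ Icc 0 t₁, Real.exp (lam / T * t) ≤ 6 / 5 := by
    intro t ht
    apply exp_le_six_fifths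
    have h1 : t ≤ C * T := ht.2.trans htC.le
    calc lam / T * t ≤ lam / T * (C * T) := by gcongr
      _ = lam * C := by field_simp
      _ ≤ 1 / 6 := hClam
  have hm : ∀ x : Space n, ∀ t ∈ Icc 0 t₁,
      (2 * Real.exp (ℓ (x, t))) ^ (-α) ≤ 2 * b * N (x, t) / T := by
    intro x t ht
    have hE0 : 0 ≤ lam / T * t := mul_nonneg (by positivity) ht.1
    have h1 : 2 * Real.exp (ℓ (x, t)) =
        (profileConst n α / n) * T ^ (-β) * Real.exp (lam / T * t) * N (x, t) ^ β := by
      rw [hexp, hk]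
      field_simp
    have hTβ := Real.rpow_pos_of_pos hT (-β)
    have hNβ := Real.rpow_pos_of_pos (hN0 (x, t)) β
    have hq : 0 < profileConst n α / n := div_pos hCα hnR
    rw [h1, ← ha, Real.mul_rpow (by positivity) hNβ.le, Real.mul_rpow (by positivity)
      (Real.exp_nonneg _), Real.mul_rpow hq.le hTβ.le, ← Real.rpow_mul hT.le,
      ← Real.rpow_mul (hN0 _).le, neg_mul, hβa, Real.rpow_one, Real.rpow_neg_one]
    -- Here `a ≤ 1`, that is `α ≥ -1`, is used.
    have h2 : Real.exp (lam / T * t) ^ a ≤ 2 := by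
      have h3 : 1 ≤ Real.exp (lam / T * t) := Real.one_le_exp hE0
      calc Real.exp (lam / T * t) ^ a ≤ Real.exp (lam / T * t) ^ (1 : ℝ) :=
            Real.rpow_le_rpow_of_exponent_le h3 (by linarith)
        _ ≤ 2 := by rw [Real.rpow_one]; linarith [htime t ht]
    calc b * T⁻¹ * Real.exp (lam / T * t) ^ a * N (x, t) ≤ b * T⁻¹ * 2 * N (x, t) := by
          have := hN0 (x, t)
          gcongr
      _ = 2 * b * N (x, t) / T := by ring
  have hm0 : ∀ z, 0 < (2 * Real.exp (ℓ z)) ^ (-α) := fun z =>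
    Real.rpow_pos_of_pos (by positivity) _
  have hxε : ∀ x : Space n, ∀ t ∈ Icc 0 t₁, ‖x‖ + ε⁻¹ * t < ρ → ε * ‖x‖ ≤ 2 * C * T := by
    intro x t ht hx
    have h1 : 0 ≤ ε⁻¹ * t := mul_nonneg (inv_pos.2 hε).le ht.1
    have h2 : ‖x‖ ≤ ρ := by linarith
    exact (mul_le_mul_of_nonneg_left h2 hε.le).trans hερ
  have hcond1 : ∀ x : Space n, ∀ t ∈ Icc 0 t₁, ‖x‖ + ε⁻¹ * t < ρ →
      (2 * Real.exp (ℓ (x, t))) ^ (-α) * (ε * (2 * β * ‖x‖ / N (x, t))) ≤ 1 / 4 := by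
    intro x t ht hx
    have hNz := hN0 (x, t)
    calc (2 * Real.exp (ℓ (x, t))) ^ (-α) * (ε * (2 * β * ‖x‖ / N (x, t)))
        ≤ 2 * b * N (x, t) / T * (ε * (2 * β * ‖x‖ / N (x, t))) := by
          gcongr
          exact hm x t ht
      _ = 4 * b * β / T * (ε * ‖x‖) := by field_simp; ring
      _ ≤ 4 * b * β / T * (2 * C * T) :=
          mul_le_mul_of_nonneg_left (hxε x t ht hx) (by positivity)
      _ = (32 * b * β * C) / 4 := by field_simp; ring
      _ ≤ 1 / 4 := by linarith
  have hPbound : ∀ i z, |p i z| ≤ 2 * β * ‖z.1‖ / N z := by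
    intro i z
    have hNz := hN0 z
    simp only [hp]
    rw [abs_div, abs_mul, abs_of_pos hNz, abs_of_pos (by positivity : 0 < 2 * β)]
    gcongr
    exact abs_inner_vel_le i z.1
  have hsuper := isSupersolution_exp_mul_one_sub hn (ρ := ρ) (t₁ := t₁)
    (abs_le.2 ⟨hα₁, by linarith⟩) hε
    (ℓ := ℓ) (L := fun _ => lam / T) (P := fun z => 2 * β * ‖z.1‖ / N z)
    (dp := fun z => ε⁻¹ * (2 * β / N z)) (p := p) hℓcd hpcd
    (fun z => by
      simp only [hp]
      rw [← Finset.sum_div, ← Finset.mul_sum, sum_inner_vel, mul_zero, zero_div])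
    hPbound hℓd
    (fun x t ht hx => by
      have hNz := hN0 (x, t)
      refine ⟨by positivity, fun i => hpd i _, hcond1 x t ht hx, ?_⟩
      have hxN : ‖x‖ ^ 2 ≤ N (x, t) := by
        simp only [hN]
        nlinarith
      calc (2 * Real.exp (ℓ (x, t))) ^ (-α) *
            (ε * (ε⁻¹ * (2 * β / N (x, t))) + 3 * (2 * β * ‖x‖ / N (x, t)) ^ 2)
          = (2 * Real.exp (ℓ (x, t))) ^ (-α) *
            (2 * β / N (x, t) + 12 * β ^ 2 * ‖x‖ ^ 2 / N (x, t) ^ 2) := by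
            field_simp
            ring
        _ ≤ (2 * b * N (x, t) / T) *
            (2 * β / N (x, t) + 12 * β ^ 2 * N (x, t) / N (x, t) ^ 2) := by
            gcongr
            exact hm x t ht
        _ = lam / T / 2 := by
            rw [hlam]
            field_simp
            ring)
  have hsmall : ∀ i : Idx n, ∀ x : Space n, ∀ t ∈ Icc 0 t₁, ‖x‖ + ε⁻¹ * t < ρ →
      |ε * ((2 * Real.exp (ℓ (x, t))) ^ (-α) * p i (x, t))| ≤ 1 / 4 := by
    intro i x t ht hx
    refine le_trans ?_ (hcond1 x t ht hx)
    rw [abs_mul, abs_mul, abs_of_pos hε, abs_of_pos (hm0 _)]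
    calc _ = (2 * Real.exp (ℓ (x, t))) ^ (-α) * (ε * |p i (x, t)|) := by ring
      _ ≤ _ := mul_le_mul_of_nonneg_left
        (mul_le_mul_of_nonneg_left (hPbound i _) hε.le) (hm0 _).le
  have hαβ : 1 / α = -β := by
    rw [hβ, ha, inv_neg, neg_neg, one_div]
  have hprofile : ∀ x : Space n, ∀ s : ℝ, 0 < s →
      (s / (‖x‖ ^ 2 + R ^ 2)) ^ (1 / α) = s ^ (-β) * N (x, 0) ^ β := by
    intro x s hs
    have hNx : 0 < ‖x‖ ^ 2 + R ^ 2 := hN0 (x, 0)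
    rw [hαβ, Real.div_rpow hs.le hNx.le, Real.rpow_neg hNx.le, div_inv_eq_mul]
  refine ⟨_, hsuper, fun i x hx => ?_, fun i x hx => ?_⟩
  all_goals
    have hNβ := Real.rpow_pos_of_pos (hN0 (x, 0)) β
    simp only [upperProfile, if_pos hα₀]
  · have h0 : (0 : ℝ) ∈ Icc 0 t₁ := left_mem_Icc.2 ht₁
    have hh := abs_le.1 (hsmall i x 0 h0 (by simpa using hx))
    have h1 : 1 / (4 * (n : ℝ)) *
        (profileConst n α * ((T - c * 0) / (‖x‖ ^ 2 + R ^ 2)) ^ (1 / α)) =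
        Real.exp (ℓ (x, 0)) * (1 / 2) := by
      rw [mul_zero, sub_zero, hprofile x T hT, hexp, hk]
      simp only [mul_zero, Real.exp_zero]
      field_simp
      norm_num
    rw [h1]
    exact mul_le_mul_of_nonneg_left (by linarith [hh.2]) (Real.exp_nonneg _)
  · have h1 : t₁ ∈ Icc 0 t₁ := right_mem_Icc.2 ht₁
    have hh := abs_le.1 (hsmall i x t₁ h1 hx)
    have hs : 0 < T - c * t₁ := by
      have : c * t₁ < c * (C * T) := mul_lt_mul_of_pos_left htC hc0
      nlinarith
    -- The profile only grows in time, so the barrier need not follow its blow-up.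
    have hsT : T ^ (-β) ≤ (T - c * t₁) ^ (-β) := by
      apply Real.rpow_le_rpow_of_nonpos hs _ (by linarith)
      have := mul_nonneg hc0.le ht₁
      linarith
    have hNt : N (x, t₁) = N (x, 0) := rfl
    have hT0 := Real.rpow_pos_of_pos hT (-β)
    have hh5 : 1 - ε * ((2 * Real.exp (ℓ (x, t₁))) ^ (-α) * p i (x, t₁)) ≤ 5 / 4 := by
      linarith [hh.1]
    refine (mul_le_mul_of_nonneg_left hh5 (Real.exp_nonneg _)).trans ?_
    rw [hprofile x _ hs, hexp, hk, hNt]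
    calc profileConst n α * T ^ (-β) / (2 * n) * Real.exp (lam / T * t₁) * N (x, 0) ^ β * (5 / 4)
        ≤ profileConst n α * T ^ (-β) / (2 * n) * (6 / 5) * N (x, 0) ^ β * (5 / 4) := by
          gcongr
          exact htime t₁ h1
      _ = 3 / (4 * n) * (profileConst n α * (T ^ (-β) * N (x, 0) ^ β)) := by
          field_simp
          norm_num
      _ ≤ 3 / (4 * n) * (profileConst n α * ((T - c * t₁) ^ (-β) * N (x, 0) ^ β)) := by
          gcongr

/-! ### Gaussian barriers for `α > 0` -/

/-- Logarithm of a growing Gaussian profile. -/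
noncomputable def gaussLog {n : ℕ} (k lam κ T : ℝ) (z : Space n × ℝ) : ℝ :=
  Real.log k + lam / T * z.2 + κ * (1 + z.2 / T) * ‖z.1‖ ^ 2 / 2

/-- Derivative of `gaussLog` in the direction `v_i`. -/
noncomputable def gaussDir {n : ℕ} (κ T : ℝ) (i : Idx n) (z : Space n × ℝ) : ℝ :=
  κ * (1 + z.2 / T) * inner ℝ (vel i) z.1

theorem contDiff_gaussLog {n : ℕ} (k lam κ T : ℝ) :
    ContDiff ℝ 1 (gaussLog k lam κ T : Space n × ℝ → ℝ) := by
  have : ContDiff ℝ 1 fun z : Space n × ℝ => ‖z.1‖ ^ 2 := contDiff_fst.norm_sq ℝ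
  unfold gaussLog
  fun_prop

theorem contDiff_gaussDir {n : ℕ} (κ T : ℝ) (i : Idx n) : ContDiff ℝ 1 (gaussDir κ T i) := by
  have : ContDiff ℝ 1 fun z : Space n × ℝ => inner ℝ (vel i) z.1 :=
    contDiff_const.inner ℝ contDiff_fst
  unfold gaussDir
  fun_prop

theorem hasDerivAt_gaussLog_line {n : ℕ} (k lam κ T ε : ℝ) (i : Idx n) (z : Space n × ℝ) :
    HasDerivAt (fun s : ℝ => gaussLog k lam κ T (z + s • ((ε⁻¹ • vel i, 1) : Space n × ℝ)))
      (lam / T + κ * ‖z.1‖ ^ 2 / (2 * T) + ε⁻¹ * gaussDir κ T i z) 0 := by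
  have ht := hasDerivAt_time_line z ε i
  have e1 := ((ht.const_mul (lam / T)).const_add (Real.log k)).add
    (((((ht.div_const T).const_add 1).const_mul κ).mul (hasDerivAt_norm_sq_line z ε i)).div_const 2)
  refine e1.congr_deriv ?_
  simp only [gaussDir, zero_smul, add_zero]
  ring

theorem hasDerivAt_gaussDir_line {n : ℕ} (κ T ε : ℝ) (i : Idx n) (z : Space n × ℝ) :
    HasDerivAt (fun s : ℝ => gaussDir κ T i (z + s • ((ε⁻¹ • vel i, 1) : Space n × ℝ)))
      (κ / T * inner ℝ (vel i) z.1 + κ * (1 + z.2 / T) * ε⁻¹) 0 := by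
  have e1 := ((((hasDerivAt_time_line z ε i).div_const T).const_add 1).const_mul κ).mul
    (hasDerivAt_inner_vel_line z ε i)
  refine e1.congr_deriv ?_
  simp only [zero_smul, add_zero]
  ring

theorem abs_gaussDir_le {n : ℕ} (κ T : ℝ) (i : Idx n) (z : Space n × ℝ) :
    |gaussDir κ T i z| ≤ |κ * (1 + z.2 / T)| * ‖z.1‖ := by
  rw [gaussDir, abs_mul]
  exact mul_le_mul_of_nonneg_left (abs_inner_vel_le i z.1) (abs_nonneg _)

theorem exp_gaussLog {n : ℕ} {k : ℝ} (hk : 0 < k) (lam κ T : ℝ) (z : Space n × ℝ) :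
    Real.exp (gaussLog k lam κ T z) =
      k * Real.exp (lam / T * z.2) * Real.exp (κ * (1 + z.2 / T) * ‖z.1‖ ^ 2 / 2) := by
  rw [gaussLog, Real.exp_add, Real.exp_add, Real.exp_log hk]

/-- The amplitude for which the Gaussian barrier lies between multiples of the upper profile. -/
noncomputable def gaussAmp (n : ℕ) (cBar R T : ℝ) : ℝ :=
  R ^ 2 / (4 * Real.pi * T) ^ ((n : ℝ) / 2 * cBar) / (2 * n)

theorem gaussAmp_pos {n : ℕ} (hn : 0 < n) (cBar : ℝ) {R T : ℝ} (hR : 0 < R) (hT : 0 < T) :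
    0 < gaussAmp n cBar R T := by
  have hnR : (0 : ℝ) < n := by exact_mod_cast hn
  have := Real.rpow_pos_of_pos (by positivity : 0 < 4 * Real.pi * T) ((n : ℝ) / 2 * cBar)
  unfold gaussAmp
  positivity

theorem gaussLog_initial {n : ℕ} (hn : 0 < n) {α : ℝ} (hα : 0 ≤ α) (c cHat cBar lam : ℝ) {R T : ℝ}
    (hR : 0 < R) (hT : 0 < T) (x : Space n) :
    1 / (4 * (n : ℝ)) * upperProfile α c cHat cBar R T x 0 =
      Real.exp (gaussLog (gaussAmp n cBar R T) lam (cHat * n / (2 * T)) T (x, 0)) * (1 / 2) := by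
  have hnR : (0 : ℝ) < n := by exact_mod_cast hn
  rw [exp_gaussLog (gaussAmp_pos hn cBar hR hT), upperProfile, if_neg (not_lt.2 hα), gaussAmp]
  have h1 : cHat * (n : ℝ) / (2 * T) * (1 + (0 : ℝ) / T) * ‖x‖ ^ 2 / 2 =
      cHat * (n : ℝ) * ‖x‖ ^ 2 / (4 * (T - 0)) := by
    rw [zero_div, sub_zero]
    ring
  simp only [mul_zero, Real.exp_zero]
  rw [h1, sub_zero]
  ring

/-- The barrier's exponent is affine in time and stays below that of the profile because `(1 +
t/T)/T ≤ 1/(T - t)`; the amplitude of the profile increases since `cBar > 0`. -/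
theorem gaussLog_final {n : ℕ} (hn : 0 < n) {α : ℝ} (hα : 0 ≤ α) (c : ℝ) {cHat cBar lam : ℝ}
    (hcHat : 0 < cHat) (hcBar : 0 < cBar) {R T : ℝ}
    (hR : 0 < R) (hT : 0 < T) {t : ℝ} (ht : 0 ≤ t) (htT : t < T) (hlam : lam / T * t ≤ 1 / 6)
    (x : Space n) :
    Real.exp (gaussLog (gaussAmp n cBar R T) lam (cHat * n / (2 * T)) T (x, t)) * (5 / 4) ≤
      3 / (4 * (n : ℝ)) * upperProfile α c cHat cBar R T x t := by
  have hnR : (0 : ℝ) < n := by exact_mod_cast hn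
  have hs : 0 < T - t := by linarith
  have hpi := Real.pi_pos
  have he : 0 < (n : ℝ) / 2 * cBar := by positivity
  rw [exp_gaussLog (gaussAmp_pos hn cBar hR hT), upperProfile, if_neg (not_lt.2 hα), gaussAmp]
  have h1 : cHat * (n : ℝ) / (2 * T) * (1 + t / T) * ‖x‖ ^ 2 / 2 ≤
      cHat * (n : ℝ) * ‖x‖ ^ 2 / (4 * (T - t)) := by
    have h2 : (1 + t / T) / T ≤ 1 / (T - t) := by
      rw [div_le_div_iff₀ hT hs]
      have : (1 + t / T) * (T - t) = T - t ^ 2 / T := by field_simp; ring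
      rw [this]
      have : 0 ≤ t ^ 2 / T := by positivity
      linarith
    calc cHat * (n : ℝ) / (2 * T) * (1 + t / T) * ‖x‖ ^ 2 / 2
        = cHat * n * ‖x‖ ^ 2 / 4 * ((1 + t / T) / T) := by field_simp; ring
      _ ≤ cHat * n * ‖x‖ ^ 2 / 4 * (1 / (T - t)) := by gcongr
      _ = _ := by field_simp
  have h3 : (4 * Real.pi * (T - t)) ^ ((n : ℝ) / 2 * cBar) ≤
      (4 * Real.pi * T) ^ ((n : ℝ) / 2 * cBar) := by
    apply Real.rpow_le_rpow (by positivity) _ he.le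
    gcongr
    linarith
  have h4 := Real.rpow_pos_of_pos (by positivity : 0 < 4 * Real.pi * (T - t)) ((n : ℝ) / 2 * cBar)
  calc R ^ 2 / (4 * Real.pi * T) ^ ((n : ℝ) / 2 * cBar) / (2 * n) * Real.exp (lam / T * t) *
        Real.exp (cHat * (n : ℝ) / (2 * T) * (1 + t / T) * ‖x‖ ^ 2 / 2) * (5 / 4)
      ≤ R ^ 2 / (4 * Real.pi * (T - t)) ^ ((n : ℝ) / 2 * cBar) / (2 * n) * (6 / 5) *
        Real.exp (cHat * (n : ℝ) * ‖x‖ ^ 2 / (4 * (T - t))) * (5 / 4) := by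
        gcongr
        exact exp_le_six_fifths hlam
    _ = _ := by
        field_simp
        norm_num

/-- For `α > 0` a large solution diffuses slowly. The bound on `R` makes `(2ψ)^(-α) ≤ 1/(24n)`,
small enough for the crude estimates of the first-order ansatz. -/
theorem hasBarriers_of_pos {n : ℕ} (hn : 0 < n) {α : ℝ} (hα₀ : 0 < α) (hα₁ : α ≤ 1) (c : ℝ)
    {cHat cBar : ℝ} (hcHat₀ : 0 < cHat) (hcHat₁ : cHat < 1) (hcBar : 0 < cBar) {R T : ℝ}
    (hR : 0 < R) (hT : 0 < T)
    (hRT : (n : ℝ) * (4 * Real.pi * T) ^ ((n : ℝ) / 2 * cBar) * (24 * n) ^ (1 / α) ≤ R ^ 2) :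
    HasBarriers n α c cHat cBar (1 / 6) R T := by
  intro ε ρ t₁ hε ht₁ htC hερ
  have hnR : (0 : ℝ) < n := by exact_mod_cast hn
  have hn1 : (1 : ℝ) ≤ n := by exact_mod_cast hn
  set k := gaussAmp n cBar R T with hk
  have hk0 : 0 < k := gaussAmp_pos hn cBar hR hT
  set κ : ℝ := cHat * n / (2 * T) with hκ
  have hκ0 : 0 < κ := by positivity
  have hκT : κ * T = cHat * n / 2 := by rw [hκ]; field_simp
  have hkm : (2 * k) ^ (-α) ≤ 1 / (24 * n) := by
    have hE := Real.rpow_pos_of_pos (by positivity : 0 < 4 * Real.pi * T) ((n : ℝ) / 2 * cBar)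
    have h1 : (24 * (n : ℝ)) ^ (1 / α) ≤ 2 * k := by
      have : 2 * k = R ^ 2 / ((n : ℝ) * (4 * Real.pi * T) ^ ((n : ℝ) / 2 * cBar)) := by
        rw [hk, gaussAmp]
        field_simp
      rw [this, le_div_iff₀ (by positivity)]
      linarith
    have h24 : (0 : ℝ) < 24 * n := by positivity
    calc (2 * k) ^ (-α) ≤ ((24 * (n : ℝ)) ^ (1 / α)) ^ (-α) :=
          Real.rpow_le_rpow_of_nonpos (Real.rpow_pos_of_pos h24 _) h1 (by linarith)
      _ = 1 / (24 * n) := by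
          rw [← Real.rpow_mul h24.le]
          have : 1 / α * -α = -1 := by field_simp
          rw [this, Real.rpow_neg_one, one_div]
  have hm0 : ∀ z : Space n × ℝ, 0 < (2 * Real.exp (gaussLog k 1 κ T z)) ^ (-α) := fun z =>
    Real.rpow_pos_of_pos (by positivity) _
  have hm : ∀ x : Space n, ∀ t ∈ Icc 0 t₁,
      (2 * Real.exp (gaussLog k 1 κ T (x, t))) ^ (-α) ≤ 1 / (24 * n) := by
    intro x t ht
    refine le_trans (Real.rpow_le_rpow_of_nonpos (by positivity) ?_ (by linarith)) hkm
    have h1 : Real.log k ≤ gaussLog k 1 κ T (x, t) := by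
      have h0 := ht.1
      have h2 : 0 ≤ 1 / T * t := by positivity
      have h3 : 0 ≤ κ * (1 + t / T) * ‖x‖ ^ 2 / 2 := by positivity
      simp only [gaussLog]
      linarith
    have h2 := Real.exp_le_exp.2 h1
    rw [Real.exp_log hk0] at h2
    linarith
  have hs : ∀ t ∈ Icc 0 t₁, 0 ≤ κ * (1 + t / T) ∧ κ * (1 + t / T) ≤ 2 * κ := by
    intro t ht
    have h0 := ht.1
    have h1 : t / T ≤ 1 := by
      rw [div_le_one hT]
      linarith [ht.2]
    have h2 := mul_le_mul_of_nonneg_left h1 hκ0.le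
    exact ⟨by positivity, by linarith⟩
  have hxε : ∀ x : Space n, ∀ t ∈ Icc 0 t₁, ‖x‖ + ε⁻¹ * t < ρ → ε * ‖x‖ ≤ T := by
    intro x t ht hx
    have h1 : 0 ≤ ε⁻¹ * t := mul_nonneg (inv_pos.2 hε).le ht.1
    have h2 : ‖x‖ ≤ ρ := by linarith
    have := (mul_le_mul_of_nonneg_left h2 hε.le).trans hερ
    linarith
  have hcond1 : ∀ x : Space n, ∀ t ∈ Icc 0 t₁, ‖x‖ + ε⁻¹ * t < ρ →
      (2 * Real.exp (gaussLog k 1 κ T (x, t))) ^ (-α) * (ε * (|κ * (1 + t / T)| * ‖x‖)) ≤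
        1 / 4 := by
    intro x t ht hx
    obtain ⟨h1, h2⟩ := hs t ht
    rw [abs_of_nonneg h1]
    calc (2 * Real.exp (gaussLog k 1 κ T (x, t))) ^ (-α) * (ε * (κ * (1 + t / T) * ‖x‖))
        ≤ 1 / (24 * n) * (2 * κ * T) := by
          refine mul_le_mul (hm x t ht) ?_ (by positivity) (by positivity)
          calc ε * (κ * (1 + t / T) * ‖x‖) = κ * (1 + t / T) * (ε * ‖x‖) := by ring
            _ ≤ 2 * κ * T := mul_le_mul h2 (hxε x t ht hx) (by positivity) (by positivity)
      _ = cHat / 24 := by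
          rw [mul_assoc 2, hκT]
          field_simp
      _ ≤ 1 / 4 := by linarith
  have hsmall : ∀ i : Idx n, ∀ x : Space n, ∀ t ∈ Icc 0 t₁, ‖x‖ + ε⁻¹ * t < ρ →
      |ε * ((2 * Real.exp (gaussLog k 1 κ T (x, t))) ^ (-α) * gaussDir κ T i (x, t))| ≤ 1 / 4 := by
    intro i x t ht hx
    refine le_trans ?_ (hcond1 x t ht hx)
    rw [abs_mul, abs_mul, abs_of_pos hε, abs_of_pos (hm0 _)]
    calc _ = (2 * Real.exp (gaussLog k 1 κ T (x, t))) ^ (-α) *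
          (ε * |gaussDir κ T i (x, t)|) := by ring
      _ ≤ _ := mul_le_mul_of_nonneg_left
        (mul_le_mul_of_nonneg_left (abs_gaussDir_le κ T i _) hε.le) (hm0 _).le
  have hsuper := isSupersolution_exp_mul_one_sub hn (ρ := ρ) (t₁ := t₁) (α := α)
    (abs_le.2 ⟨by linarith, hα₁⟩) hε
    (ℓ := gaussLog k 1 κ T) (L := fun z => 1 / T + κ * ‖z.1‖ ^ 2 / (2 * T))
    (P := fun z => |κ * (1 + z.2 / T)| * ‖z.1‖)
    (dp := fun z => κ / T * ‖z.1‖ + κ * (1 + z.2 / T) * ε⁻¹) (p := gaussDir κ T)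
    (contDiff_gaussLog k 1 κ T) (contDiff_gaussDir κ T)
    (fun z => by simp only [gaussDir, ← Finset.mul_sum, sum_inner_vel, mul_zero])
    (abs_gaussDir_le κ T)
    (fun i z => fderiv_eq_of_hasDerivAt_line
      ((contDiff_gaussLog k 1 κ T).differentiable (by simp) z)
      (hasDerivAt_gaussLog_line k 1 κ T ε i z))
    (fun x t ht hx => by
      obtain ⟨h1, h2⟩ := hs t ht
      refine ⟨by positivity, fun i => ?_, hcond1 x t ht hx, ?_⟩
      · rw [fderiv_eq_of_hasDerivAt_line ((contDiff_gaussDir κ T i).differentiable (by simp) _)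
          (hasDerivAt_gaussDir_line κ T ε i (x, t))]
        have := (le_abs_self _).trans (abs_inner_vel_le i x)
        have := mul_le_mul_of_nonneg_left this (by positivity : 0 ≤ κ / T)
        simp only
        linarith
      · simp only
        rw [abs_of_nonneg h1]
        have hb : ε * (κ / T * ‖x‖ + κ * (1 + t / T) * ε⁻¹) +
            3 * (κ * (1 + t / T) * ‖x‖) ^ 2 ≤ 3 * κ + 12 * κ ^ 2 * ‖x‖ ^ 2 := by
          have e1 : ε * (κ / T * ‖x‖ + κ * (1 + t / T) * ε⁻¹) =
              κ * (ε * ‖x‖ / T) + κ * (1 + t / T) := by field_simp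
          have e2 : ε * ‖x‖ / T ≤ 1 := by
            rw [div_le_one hT]
            exact hxε x t ht hx
          have e3 := mul_le_mul_of_nonneg_left e2 hκ0.le
          have e4 : (κ * (1 + t / T) * ‖x‖) ^ 2 ≤ (2 * κ * ‖x‖) ^ 2 := by
            gcongr
          rw [e1]
          calc _ ≤ 3 * κ + 3 * (2 * κ * ‖x‖) ^ 2 := by linarith
            _ = _ := by ring
        -- The number 24 comes from here: as `κ/n = cHat/(2T)`, it turns `12κ²‖x‖²` into `cHat`
        -- times the quadratic part of `L/2`.
        calc _ ≤ 1 / (24 * n) * (3 * κ + 12 * κ ^ 2 * ‖x‖ ^ 2) := by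
              refine mul_le_mul (hm x t ht) hb ?_ (by positivity)
              have h0 := ht.1
              positivity
          _ = cHat / (16 * T) + κ * cHat * ‖x‖ ^ 2 / (4 * T) := by
              rw [hκ]
              field_simp
              ring
          _ ≤ 1 / (2 * T) + κ * 1 * ‖x‖ ^ 2 / (4 * T) := by
              have : cHat / (16 * T) ≤ 1 / (2 * T) := by
                rw [div_le_div_iff₀ (by positivity) (by positivity)]
                nlinarith
              gcongr
          _ = _ := by
              field_simp
              ring)
  refine ⟨_, hsuper, fun i x hx => ?_, fun i x hx => ?_⟩
  · have hh := abs_le.1 (hsmall i x 0 (left_mem_Icc.2 ht₁) (by simpa using hx))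
    rw [gaussLog_initial hn hα₀.le c cHat cBar 1 hR hT x]
    exact mul_le_mul_of_nonneg_left (by linarith [hh.2]) (Real.exp_nonneg _)
  · have hh := abs_le.1 (hsmall i x t₁ (right_mem_Icc.2 ht₁) hx)
    refine le_trans (mul_le_mul_of_nonneg_left (by linarith [hh.1]) (Real.exp_nonneg _))
      (gaussLog_final hn hα₀.le c hcHat₀ hcBar hR hT ht₁ (by linarith) (lam := 1) ?_ x)
    rw [one_div, inv_mul_eq_div, div_le_iff₀ hT]
    linarith

/-! ### Gaussian barriers for `α = 0` -/

/-- For constant rates, the second-order expansion `exp ℓ (1 - ε p_i + ε² p_i²)` is a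
supersolution if `ℓ` grows sufficiently fast in time and `p_i` is the derivative of `ℓ` in the
direction `v_i`. -/
theorem isSupersolution_zero {n : ℕ} (hn : 0 < n) {ε ρ t₁ : ℝ}
    (hε : 0 < ε) {ℓ L : Space n × ℝ → ℝ} {p dp : Idx n → Space n × ℝ → ℝ}
    (hℓ : ContDiff ℝ 1 ℓ) (hp : ∀ i, ContDiff ℝ 1 (p i)) (hp0 : ∀ z, ∑ i, p i z = 0)
    (hℓd : ∀ i z, HasDerivAt (fun s : ℝ => ℓ (z + s • ((ε⁻¹ • vel i, 1) : Space n × ℝ)))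
      (L z + ε⁻¹ * p i z) 0)
    (hpd : ∀ i z, HasDerivAt (fun s : ℝ => p i (z + s • ((ε⁻¹ • vel i, 1) : Space n × ℝ)))
      (dp i z) 0)
    (h : ∀ x : Space n, ∀ t ∈ Icc 0 t₁, ‖x‖ + ε⁻¹ * t < ρ → ∀ i,
      (∑ j, p j (x, t) ^ 2) / (2 * n) ≤
        L (x, t) * (1 - ε * p i (x, t) + ε ^ 2 * p i (x, t) ^ 2) + ε * p i (x, t) ^ 3 -
          ε * dp i (x, t) * (1 - 2 * (ε * p i (x, t)))) :
    IsSupersolution 0 ε ρ t₁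
      (fun i z => Real.exp (ℓ z) * (1 - ε * p i z + ε ^ 2 * p i z ^ 2)) := by
  have hnR : (0 : ℝ) < n := by exact_mod_cast hn
  have hcd : ∀ i, ContDiff ℝ 1
      (fun z => Real.exp (ℓ z) * (1 - ε * p i z + ε ^ 2 * p i z ^ 2)) := by
    intro i
    have := hp i
    fun_prop
  refine ⟨hcd, fun x t ht hx i => mul_pos (Real.exp_pos _) ?_, fun x t ht hx i => ?_⟩
  · nlinarith [sq_nonneg (ε * p i (x, t) - 1 / 2)]
  · set z : Space n × ℝ := (x, t) with hz
    have e1 := (hℓd i z).exp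
    have e2 := (((hpd i z).const_mul ε).const_sub 1).add (((hpd i z).pow 2).const_mul (ε ^ 2))
    have e3 := e1.mul e2
    have hder := fderiv_eq_of_hasDerivAt_line ((hcd i).differentiable (by simp) z) e3
    rw [hder, collision_zero hn]
    simp only [zero_smul, add_zero, Pi.add_apply, Pi.pow_apply]
    have hcard : (Finset.univ : Finset (Idx n)).card = 2 * n := by
      simp [two_mul]
    have hsum : ∑ j, Real.exp (ℓ z) * (1 - ε * p j z + ε ^ 2 * p j z ^ 2) =
        Real.exp (ℓ z) * (2 * n + ε ^ 2 * ∑ j, p j z ^ 2) := by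
      rw [← Finset.mul_sum, Finset.sum_add_distrib, Finset.sum_sub_distrib, ← Finset.mul_sum, hp0,
        ← Finset.mul_sum, Finset.sum_const, hcard, nsmul_eq_mul]
      push_cast
      ring
    rw [hsum]
    have hlhs : (Real.exp (ℓ z) * (2 * n + ε ^ 2 * ∑ j, p j z ^ 2) / (2 * n) -
        Real.exp (ℓ z) * (1 - ε * p i z + ε ^ 2 * p i z ^ 2)) / ε ^ 2 =
        Real.exp (ℓ z) * ((∑ j, p j z ^ 2) / (2 * n) + ε⁻¹ * p i z - p i z ^ 2) := by
      field_simp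
      ring
    rw [hlhs]
    -- Both `ε⁻¹ p_i` and `-p_i²` occur on the two sides and cancel. The second-order term thus
    -- replaces `p_i²` by its average over the velocities, `|∇ℓ|²/n` when `p_i = v_i · ∇ℓ`, as in
    -- the limiting heat equation.
    calc Real.exp (ℓ z) * ((∑ j, p j z ^ 2) / (2 * n) + ε⁻¹ * p i z - p i z ^ 2)
        ≤ Real.exp (ℓ z) * ((L z * (1 - ε * p i z + ε ^ 2 * p i z ^ 2) + ε * p i z ^ 3 -
          ε * dp i z * (1 - 2 * (ε * p i z))) + ε⁻¹ * p i z - p i z ^ 2) := by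
          gcongr
          exact h x t ht hx i
      _ = _ := by
          push_cast
          field_simp
          ring

/-- The quadratic part of the heat balance closes with ratio `cHat < 1`. The cubic term, the growth
of `s` and the factor of `L` are perturbations of relative size `δ`, fitting into the margin since
`(4 + 4n)δ = 1 - cHat`. The bounded term `d` is paid for by `8n/T`. -/
theorem gaussian_balance {n cHat δ T κ s X ε g d : ℝ} (hn : 1 ≤ n) (hcHat₀ : 0 < cHat)
    (hcHat₁ : cHat < 1) (hδ0 : 0 < δ) (hδ8 : δ ≤ 1 / 8) (hδn : (4 + 4 * n) * δ = 1 - cHat)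
    (hT : 0 < T) (hκ : κ = cHat * n / (2 * T)) (hs0 : 0 ≤ s) (hs : s ≤ κ * (1 + δ))
    (hg : g ^ 2 ≤ s ^ 2 * X ^ 2) (hεg : |ε * g| ≤ δ) (hd : |d| ≤ 4 * κ) :
    1 / n * (s ^ 2 * X ^ 2) ≤ (8 * n / T + κ * X ^ 2 / (2 * T)) *
      (1 - ε * g + ε ^ 2 * g ^ 2) + ε * g ^ 3 - d * (1 - 2 * (ε * g)) := by
  have hn0 : 0 < n := by linarith
  have hκ0 : 0 < κ := by rw [hκ]; positivity
  have hq := abs_le.1 hεg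
  have hcube : -(δ * (s ^ 2 * X ^ 2)) ≤ ε * g ^ 3 := by
    have e2 : -δ * g ^ 2 ≤ ε * g * g ^ 2 := mul_le_mul_of_nonneg_right hq.1 (sq_nonneg _)
    have e3 := mul_le_mul_of_nonneg_left hg hδ0.le
    linarith
  have hlow : 1 - δ ≤ 1 - ε * g + ε ^ 2 * g ^ 2 := by
    linarith [sq_nonneg (ε * g), hq.2]
  have hss : s ^ 2 ≤ κ ^ 2 * (1 + 3 * δ) := by
    have e1 : (1 + δ) ^ 2 ≤ 1 + 3 * δ := by nlinarith
    calc s ^ 2 ≤ (κ * (1 + δ)) ^ 2 := pow_le_pow_left₀ hs0 hs 2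
      _ = κ ^ 2 * (1 + δ) ^ 2 := by ring
      _ ≤ κ ^ 2 * (1 + 3 * δ) := mul_le_mul_of_nonneg_left e1 (sq_nonneg _)
  have hscal : cHat * ((1 + n * δ) * (1 + 3 * δ)) ≤ 1 - δ := by
    have e1 : (1 + n * δ) * (1 + 3 * δ) ≤ 1 + (3 + 4 * n) * δ := by
      have : n * δ * (3 * δ) ≤ n * δ * 3 := by
        apply mul_le_mul_of_nonneg_left _ (by positivity)
        linarith
      linarith
    have e2 : 0 ≤ (3 + 4 * n) * δ := by positivity
    have e3 := mul_le_mul_of_nonneg_left e1 hcHat₀.le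
    have e4 := mul_le_mul_of_nonneg_right hcHat₁.le e2
    linarith
  have hquad : (1 / n + δ) * (s ^ 2 * X ^ 2) ≤ κ * X ^ 2 / (2 * T) * (1 - δ) := by
    calc (1 / n + δ) * (s ^ 2 * X ^ 2)
        ≤ (1 / n + δ) * (κ ^ 2 * (1 + 3 * δ) * X ^ 2) :=
          mul_le_mul_of_nonneg_left (mul_le_mul_of_nonneg_right hss (sq_nonneg _)) (by positivity)
      _ = κ * X ^ 2 / (2 * T) * (cHat * ((1 + n * δ) * (1 + 3 * δ))) := by
          rw [hκ]
          field_simp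
      _ ≤ κ * X ^ 2 / (2 * T) * (1 - δ) := mul_le_mul_of_nonneg_left hscal (by positivity)
  have hdp : d * (1 - 2 * (ε * g)) ≤ 4 * n / T := by
    calc d * (1 - 2 * (ε * g)) ≤ |d| * |1 - 2 * (ε * g)| := by
          rw [← abs_mul]
          exact le_abs_self _
      _ ≤ 4 * κ * 2 := by
          refine mul_le_mul hd ?_ (abs_nonneg _) (by positivity)
          rw [abs_le]
          constructor <;> linarith
      _ = cHat * (4 * n / T) := by
          rw [hκ]
          field_simp
      _ ≤ 1 * (4 * n / T) := mul_le_mul_of_nonneg_right hcHat₁.le (by positivity)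
      _ = 4 * n / T := one_mul _
  have hLmul := mul_le_mul_of_nonneg_left hlow
    (by positivity : 0 ≤ 8 * n / T + κ * X ^ 2 / (2 * T))
  have h8 : 4 * n / T ≤ 8 * n / T * (1 - δ) := by
    have : 0 ≤ 4 * n / T := by positivity
    calc 4 * n / T ≤ 4 * n / T * (2 * (1 - δ)) := le_mul_of_one_le_right this (by linarith)
      _ = _ := by ring
  linarith

/-- The problem is linear, so the amplitude `R²` is immaterial and every `R > 0` is allowed; all
smallness comes from `C`. -/
theorem hasBarriers_zero {n : ℕ} (hn : 0 < n) (c : ℝ) {cHat cBar : ℝ} (hcHat₀ : 0 < cHat)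
    (hcHat₁ : cHat < 1) (hcBar : 0 < cBar) :
    ∃ C : ℝ, 0 < C ∧ C ≤ 1 ∧
      ∀ R T : ℝ, 0 < R → 0 < T → HasBarriers n 0 c cHat cBar C R T := by
  have hnR : (0 : ℝ) < n := by exact_mod_cast hn
  have hn1 : (1 : ℝ) ≤ n := by exact_mod_cast hn
  set δ : ℝ := (1 - cHat) / (4 + 4 * n) with hδ
  have hδ0 : 0 < δ := div_pos (by linarith) (by positivity)
  have hδn : (4 + 4 * n) * δ = 1 - cHat := by
    rw [hδ]; field_simp
  have hδ8 : δ ≤ 1 / 8 := by nlinarith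
  -- The first entry bounds the growth `8nC` by `1/6`; the second bounds `ε|p_i| ≤ 2nC` by `δ`.
  set C : ℝ := min (1 / (48 * n)) (δ / (2 * n)) with hC
  have hC0 : 0 < C := lt_min (by positivity) (by positivity)
  have hC48 : 8 * n * C ≤ 1 / 6 := by
    have : C ≤ 1 / (48 * n) := min_le_left _ _
    rw [le_div_iff₀ (by positivity)] at this
    linarith
  have hCδ : 2 * n * C ≤ δ := by
    have : C ≤ δ / (2 * n) := min_le_right _ _
    rw [le_div_iff₀ (by positivity)] at this
    linarith
  have hC1 : 2 * C ≤ δ := by nlinarith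
  refine ⟨C, hC0, by linarith, fun R T hR hT ε ρ t₁ hε ht₁ htC hερ => ?_⟩
  set k := gaussAmp n cBar R T with hk
  set κ : ℝ := cHat * n / (2 * T) with hκ
  have hκ0 : 0 < κ := by positivity
  have hκT : κ * T = cHat * n / 2 := by rw [hκ]; field_simp
  have hs : ∀ t ∈ Icc 0 t₁, 0 ≤ κ * (1 + t / T) ∧ κ * (1 + t / T) ≤ κ * (1 + δ) := by
    intro t ht
    have h0 := ht.1
    have h1 : t / T ≤ δ := by
      rw [div_le_iff₀ hT]
      have := mul_le_mul_of_nonneg_right hC1 hT.le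
      nlinarith [ht.2]
    exact ⟨by positivity, mul_le_mul_of_nonneg_left (by linarith) hκ0.le⟩
  have hxε : ∀ x : Space n, ∀ t ∈ Icc 0 t₁, ‖x‖ + ε⁻¹ * t < ρ → ε * ‖x‖ ≤ 2 * C * T := by
    intro x t ht hx
    have h1 : 0 ≤ ε⁻¹ * t := mul_nonneg (inv_pos.2 hε).le ht.1
    have h2 : ‖x‖ ≤ ρ := by linarith
    exact (mul_le_mul_of_nonneg_left h2 hε.le).trans hερ
  have hsmall : ∀ i : Idx n, ∀ x : Space n, ∀ t ∈ Icc 0 t₁, ‖x‖ + ε⁻¹ * t < ρ →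
      |ε * gaussDir κ T i (x, t)| ≤ δ := by
    intro i x t ht hx
    obtain ⟨h1, h2⟩ := hs t ht
    rw [abs_mul, abs_of_pos hε]
    calc ε * |gaussDir κ T i (x, t)| ≤ ε * (|κ * (1 + t / T)| * ‖x‖) :=
          mul_le_mul_of_nonneg_left (abs_gaussDir_le κ T i _) hε.le
      _ = κ * (1 + t / T) * (ε * ‖x‖) := by rw [abs_of_nonneg h1]; ring
      _ ≤ κ * (1 + δ) * (2 * C * T) :=
          mul_le_mul h2 (hxε x t ht hx) (by positivity) (by positivity)
      _ = (κ * T) * (1 + δ) * (2 * C) := by ring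
      _ ≤ (n / 2) * 2 * (2 * C) := by
          gcongr
          · rw [hκT]
            nlinarith
          · linarith
      _ ≤ δ := by linarith
  have hsuper := isSupersolution_zero hn (ρ := ρ) (t₁ := t₁) hε
    (ℓ := gaussLog k (8 * n) κ T) (L := fun z => 8 * n / T + κ * ‖z.1‖ ^ 2 / (2 * T))
    (dp := fun i z => κ / T * inner ℝ (vel i) z.1 + κ * (1 + z.2 / T) * ε⁻¹) (p := gaussDir κ T)
    (contDiff_gaussLog k _ κ T) (contDiff_gaussDir κ T)
    (fun z => by simp only [gaussDir, ← Finset.mul_sum, sum_inner_vel, mul_zero])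
    (fun i z => hasDerivAt_gaussLog_line k _ κ T ε i z)
    (fun i z => hasDerivAt_gaussDir_line κ T ε i z)
    (fun x t ht hx i => by
      obtain ⟨h1, h2⟩ := hs t ht
      have hsm := hsmall i x t ht hx
      set s : ℝ := κ * (1 + t / T) with hs'
      have hsumsq : ∑ j : Idx n, gaussDir κ T j (x, t) ^ 2 = 2 * (s ^ 2 * ‖x‖ ^ 2) := by
        simp only [gaussDir, mul_pow, ← Finset.mul_sum, sum_inner_vel_sq]
        rw [hs']
        ring
      have hgsq : gaussDir κ T i (x, t) ^ 2 ≤ s ^ 2 * ‖x‖ ^ 2 := by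
        rw [← mul_pow, ← sq_abs]
        have := abs_gaussDir_le κ T i (x, t)
        simp only at this
        rw [← hs', abs_of_nonneg h1] at this
        exact pow_le_pow_left₀ (abs_nonneg _) this 2
      have hdp : |ε * (κ / T * inner ℝ (vel i) x + s * ε⁻¹)| ≤ 4 * κ := by
        have e1 : ε * (κ / T * inner ℝ (vel i) x + s * ε⁻¹) =
            κ * (ε * inner ℝ (vel i) x / T) + s := by field_simp
        have e2 : |ε * inner ℝ (vel i) x / T| ≤ 1 := by
          rw [abs_div, abs_mul, abs_of_pos hε, abs_of_pos hT, div_le_one hT]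
          calc ε * |inner ℝ (vel i) x| ≤ ε * ‖x‖ :=
                mul_le_mul_of_nonneg_left (abs_inner_vel_le i x) hε.le
            _ ≤ 2 * C * T := hxε x t ht hx
            _ ≤ 1 * T := mul_le_mul_of_nonneg_right (by linarith) hT.le
            _ = T := one_mul T
        have e3 : s ≤ κ * 2 := h2.trans (mul_le_mul_of_nonneg_left (by linarith) hκ0.le)
        rw [e1]
        calc |κ * (ε * inner ℝ (vel i) x / T) + s|
            ≤ κ * |ε * inner ℝ (vel i) x / T| + s := by
              refine (abs_add_le _ _).trans ?_
              rw [abs_mul, abs_of_pos hκ0, abs_of_nonneg h1]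
          _ ≤ κ * 1 + κ * 2 := add_le_add (mul_le_mul_of_nonneg_left e2 hκ0.le) e3
          _ ≤ 4 * κ := by linarith
      rw [hsumsq]
      have hlhs : 2 * (s ^ 2 * ‖x‖ ^ 2) / (2 * n) = 1 / n * (s ^ 2 * ‖x‖ ^ 2) := by
        field_simp
      rw [hlhs]
      exact gaussian_balance hn1 hcHat₀ hcHat₁ hδ0 hδ8 hδn hT hκ h1 h2 hgsq hsm hdp)
  have hh : ∀ i : Idx n, ∀ x : Space n, ∀ t ∈ Icc 0 t₁, ‖x‖ + ε⁻¹ * t < ρ →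
      1 / 2 ≤ 1 - ε * gaussDir κ T i (x, t) + ε ^ 2 * gaussDir κ T i (x, t) ^ 2 ∧
      1 - ε * gaussDir κ T i (x, t) + ε ^ 2 * gaussDir κ T i (x, t) ^ 2 ≤ 5 / 4 := by
    intro i x t ht hx
    have hsm := abs_le.1 (hsmall i x t ht hx)
    rw [← mul_pow]
    constructor <;> nlinarith
  refine ⟨_, hsuper, fun i x hx => ?_, fun i x hx => ?_⟩
  · have h1 := hh i x 0 (left_mem_Icc.2 ht₁) (by simpa using hx)
    rw [gaussLog_initial hn le_rfl c cHat cBar (8 * n) hR hT x]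
    exact mul_le_mul_of_nonneg_left h1.1 (Real.exp_nonneg _)
  · have h1 := hh i x t₁ (right_mem_Icc.2 ht₁) hx
    have hC2 : C * T < T := by nlinarith
    refine le_trans (mul_le_mul_of_nonneg_left h1.2 (Real.exp_nonneg _))
      (gaussLog_final hn le_rfl c hcHat₀ hcBar hR hT ht₁ (by linarith) (lam := 8 * n) ?_ x)
    calc 8 * n / T * t₁ ≤ 8 * n / T * (C * T) := by gcongr
      _ = 8 * n * C := by field_simp
      _ ≤ 1 / 6 := hC48

/-! ### Conclusion -/

/-- The upper bound for mild solutions, given barriers in all cones of moderate size. -/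
theorem HasBarriers.exists_pos_forall_le {n : ℕ} {α c cHat cBar C R T : ℝ} (hα : |α| ≤ 1)
    (hC : 0 < C) (hT : 0 < T) (h : HasBarriers n α c cHat cBar C R T)
    {K : Set (Space n × ℝ)} (hK : IsCompact K) (hKs : K ⊆ univ ×ˢ Ico 0 (C * T)) :
    ∃ εK : ℝ, 0 < εK ∧ ∀ g : Idx n → Space n → ℝ,
      (∀ i, ∀ᵐ x, g i x ≤ 1 / (4 * (n : ℝ)) * upperProfile α c cHat cBar R T x 0) →
      ∀ ε : ℝ, 0 < ε → ε < εK → ∀ τ : ℝ, 0 < τ → ∀ u : Idx n → ℝ → Space n → ℝ,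
        IsMildSolution α ε τ g u → ∀ i, ∀ t ∈ Icc 0 τ, ∀ᵐ x, (x, t) ∈ K →
          u i t x ≤ 3 / (4 * (n : ℝ)) * upperProfile α c cHat cBar R T x t := by
  obtain ⟨r, hr0, hr⟩ := hK.isBounded.exists_pos_norm_le
  have hCT : 0 < C * T := mul_pos hC hT
  refine ⟨C * T / (r + 1), by positivity, fun g hg ε hε hεK τ hτ u hu i t ht => ?_⟩
  by_cases htC : t < C * T
  · rw [lt_div_iff₀ (by linarith)] at hεK
    -- At time `t` this cone still has radius `r + 1`, so it contains the slice of `K`. The choice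
    -- of `εK` gives `ε ρ = ε(r + 1) + t ≤ 2CT`.
    set ρ : ℝ := r + 1 + ε⁻¹ * t with hρ
    have hεt : 0 ≤ ε⁻¹ * t := mul_nonneg (inv_pos.2 hε).le ht.1
    have hερ : ε * ρ ≤ 2 * C * T := by
      have : ε * ρ = ε * (r + 1) + t := by rw [hρ]; field_simp
      linarith
    obtain ⟨U, hU, hU0, hUt⟩ := h ε ρ t hε ht.1 htC hερ
    have hle := hu.le_of_isSupersolution hα hε hτ (by linarith) ht hU (fun j => by
      filter_upwards [hg j] with x hx hxρ
      exact hx.trans (hU0 j x hxρ)) i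
    filter_upwards [hle] with x hx hxK
    have hxr : ‖x‖ ≤ r := (norm_fst_le (x, t)).trans (hr _ hxK)
    have hcone : ‖x‖ + ε⁻¹ * t < ρ := by linarith
    exact (hx hcone).trans (hUt i x hcone)
  · exact ae_of_all _ fun x hxK => absurd (hKs hxK).2.2 htC

end Carleman

theorem proposition7p3 (n : ℕ) (hn : 2 ≤ n) (α : ℝ) (hα : |α| ≤ 1)
    (c : ℝ) (hc : 1 < c) (cHat cBar : ℝ) (hcHat₀ : 0 < cHat) (hcHat₁ : cHat < 1)
    (hcBar : cHat < cBar) :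
    ∃ (C : ℝ) (R₀ : ℝ → ℝ),
      0 < C ∧ C ≤ 1 ∧ (α < 0 → C * c ≤ 1) ∧ (α ≤ 0 → ∀ T : ℝ, R₀ T = 0) ∧
      ∀ T : ℝ, 0 < T → ∀ R : ℝ, 0 < R → R₀ T < R →
      ∀ K : Set (Carleman.Space n × ℝ), IsCompact K → K ⊆ Set.univ ×ˢ Set.Ico 0 (C * T) →
      ∃ εK : ℝ, 0 < εK ∧
        ∀ g : Carleman.Idx n → Carleman.Space n → ℝ,
          (∀ i, LocallyIntegrable (g i) volume) →
          (∀ i, ∀ᵐ x, 0 ≤ g i x) →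
          (∀ i, ∀ᵐ x, g i x ≤
            1 / (4 * (n : ℝ)) * Carleman.upperProfile α c cHat cBar R T x 0) →
        ∀ ε : ℝ, 0 < ε → ε < εK →
        ∀ τ : ℝ, 0 < τ →
        ∀ u : Carleman.Idx n → ℝ → Carleman.Space n → ℝ,
          Carleman.IsMildSolution α ε τ g u →
        ∀ i, ∀ t ∈ Set.Icc 0 τ, ∀ᵐ x, (x, t) ∈ K →
          u i t x ≤ 3 / (4 * (n : ℝ)) * Carleman.upperProfile α c cHat cBar R T x t := by
  have hn0 : 0 < n := by omega
  obtain ⟨hα1, hα2⟩ := abs_le.1 hα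
  have hcBar0 : 0 < cBar := hcHat₀.trans hcBar
  suffices hmain : ∃ (C : ℝ) (R₀ : ℝ → ℝ),
      0 < C ∧ C ≤ 1 ∧ (α < 0 → C * c ≤ 1) ∧ (α ≤ 0 → ∀ T : ℝ, R₀ T = 0) ∧
      ∀ T : ℝ, 0 < T → ∀ R : ℝ, 0 < R → R₀ T < R →
        Carleman.HasBarriers n α c cHat cBar C R T by
    obtain ⟨C, R₀, hC0, hC1, hCc, hR₀, hB⟩ := hmain
    refine ⟨C, R₀, hC0, hC1, hCc, hR₀, fun T hT R hR hRT K hK hKs => ?_⟩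
    obtain ⟨εK, hεK, h⟩ := (hB T hT R hR hRT).exists_pos_forall_le hα hC0 hT hK hKs
    exact ⟨εK, hεK, fun g _ _ hg => h g hg⟩
  rcases lt_trichotomy α 0 with hneg | rfl | hpos
  · obtain ⟨C, hC0, hC1, hCc, hB⟩ :=
      Carleman.hasBarriers_of_neg hn0 hα1 hneg hc cHat cBar
    exact ⟨C, fun _ => 0, hC0, hC1, fun _ => hCc, fun _ _ => rfl,
      fun T hT R hR _ => hB R T hR hT⟩
  · obtain ⟨C, hC0, hC1, hB⟩ := Carleman.hasBarriers_zero hn0 c hcHat₀ hcHat₁ hcBar0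
    exact ⟨C, fun _ => 0, hC0, hC1, fun h => absurd h (lt_irrefl _), fun _ _ => rfl,
      fun T hT R hR _ => hB R T hR hT⟩
  -- The threshold is the square root of the lower bound on `R²` that forces `2k ≥ (24n)^(1/α)` for
  -- the barrier's amplitude `k`.
  · refine ⟨1 / 6, fun T => Real.sqrt ((n : ℝ) * (4 * Real.pi * T) ^ ((n : ℝ) / 2 * cBar) *
      (24 * n) ^ (1 / α)), by norm_num, by norm_num, fun h => absurd h hpos.not_gt,
      fun h => absurd h hpos.not_ge, fun T hT R hR hRT => ?_⟩
    exact Carleman.hasBarriers_of_pos hn0 hpos hα2 c hcHat₀ hcHat₁ hcBar0 hR hT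
      (Real.sqrt_le_left hR.le |>.1 hRT.le)
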